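/- **Conventions.** Manifolds are smooth, Hausdorff, σ-compact and without boundary. A Courant algebroid over $M$ is a real vector bundle $E\to M$ with a fibrewise nondegenerate symmetric pairing $\langle\cdot,\cdot\rangle$, an $\mathbb R$-bilinear bracket on $\Gamma(E)$ and an anchor $\pi\colon E\to TM$ such that $[e_1,[e_2,e_3]]=[[e_1,e_2],e_3]+[e_2,[e_1,e_3]]$, $\pi[e_1,e_2]=[\pi e_1,\pi e_2]$, $[e_1,fe_2]=\pi(e_1)(f)e_2+f[e_1,e_2]$, $\pi(e_1)\langle e_2,e_3\rangle=\langle[e_1,e_2],e_3\rangle+\langle e_2,[e_1,e_3]\rangle$ and $2[e,e]=\pi^*d\langle e,e\rangle$. A generalized metric is an orthogonal decomposition $E=V_+\oplus V_-$ into smooth subbundles; $e^\pm$ denotes the projection of $e$ to $V_\pm$. A divergence operator is an additive map $div\colon\Gamma(E)\to C^\infty(M)$ with $div(fe)=\pi(e)(f)+f\,div(e)$. A generalized connection $D$ satisfies $D_{e_1}(fe_2)=\pi(e_1)(f)e_2+fD_{e_1}e_2$ (and is additive in $e_2$ and $C^\infty(M)$-linear in $e_1$) and $\pi(e_1)\langle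 e_2,e_3\rangle=\langle D_{e_1}e_2,e_3\rangle+\langle e_2,D_{e_1}e_3\rangle$; its torsion is $T_D(e_1,e_2,e_3)=\langle D_{e_1}e_2-D_{e_2}e_1-[e_1,e_2],e_3\rangle+\langle D_{e_3}e_1,e_2\rangle$ and its divergence is $div_D(e)=\operatorname{tr}(De)$. Let $\mathcal D(V_+,div)$ be the set of generalized connections $D$ with $D(\Gamma(V_\pm))\subset\Gamma(E^*\otimes V_\pm)$, $T_D=0$ and $div_D=div$. For such $D$, $$Ric_D^\pm(e^\mp,e^\pm)=\operatorname{tr}_{V_\pm}\big(d^\pm\mapsto D_{d^\pm}D_{e^\mp}e^\pm-D_{e^\mp}D_{d^\pm}e^\pm-D_{[d^\pm,e^\mp]}e^\pm\big),$$ and $Ric^\pm(V_+,div)$ is $Ric^\pm_D$ for any choice of $D\in\mathcal D(V_+,div)$. An equivariant Courant algebroid $(E,M,T)$ with base $B$ is a Courant algebroid $E$ over a smooth principal $T$-bundle $p\colon M\to B=M/T$, $T$ a torus, with a smooth lift of the $T$-action to $E$ by fibrewise linear maps preserving pairing, anchor and bracket. Its simple reduction is the Courant algebroid $E/T\to B$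 with $\Gamma(E/T)=\Gamma(E)^T$ and the induced pairing, anchor ($dp\circ\pi$) and bracket. $T$-invariant objects on $E$ push forward to $E/T$: $p_*V_+\subset E/T$ is the subbundle of classes of elements of $V_+$; for $e\in\Gamma(E)^T$, $(p_*div)(e)$ is the function on $B$ whose pull-back to $M$ is $div(e)$; and for $a,c\in\Gamma(E)^T$, $(p_*Ric^\pm)(a,c)$ is the function on $B$ whose pull-back to $M$ is $Ric^\pm(a^\mp,c^\pm)$. **Proposition.** Let $(E,M,T)$ and $(\hat E,\hat M,\hat T)$ be equivariant Courant algebroids over the same base $B=M/T=\hat M/\hat T$, with bundle projections $p\colon M\to B$ and $\hat p\colon\hat M\to B$, and let $\psi\colon E/T\to\hat E/\hat T$ be an isomorphism of Courant algebroids over $B$. Let $V_+$ and $div$ be a $T$-invariant generalized metric and divergence operator on $E$, and $\hat V_+$ and $\hat{div}$ a $\hat T$-invariant generalized metric and divergence operator on $\hat E$, such that $$\psi(p_*V_+)=\hat p_*\hat V_+\qquad\text{and}\qquad p_*div=\psi^*\hat p_*\hat{div}.$$ 1. If neither $V_+$ nor $V_-$ has rank $1$ at any point, then $\mathcal D(V_+,div)\neq\emptyset$;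 likewise, if neither $\hat V_+$ nor $\hat V_-$ has rank $1$ at any point, then $\mathcal D(\hat V_+,\hat{div})\neq\emptyset$. 2. For every $D\in\mathcal D(V_+,div)$ and every $\hat D\in\mathcal D(\hat V_+,\hat{div})$, the Ricci tensors $Ric_D^\pm$ and $Ric_{\hat D}^\pm$ can be pushed forward to $B$, and $$p_*Ric_D^\pm=\psi^*\hat p_*Ric_{\hat D}^\pm.$$ That is, $p_*Ric^\pm(V_+,div)=\psi^*\hat p_*Ric^\pm(\hat V_+,\hat{div})$, for whatever connections are chosen to compute the two sides. -/

import Mathlib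

open Bundle
open scoped Manifold ContDiff

noncomputable section

namespace CourantGeometry

/-! ## Smooth sections of a vector bundle

All manifolds are smooth, finite dimensional and without boundary, modelled on
`EuclideanSpace ℝ (Fin m)`; vector bundles are smooth, real and of finite rank. -/

section Sections

variable (m : ℕ) {M : Type*} [TopologicalSpace M] [ChartedSpace (EuclideanSpace ℝ (Fin m)) M]
  (F : Type*) [NormedAddCommGroup F] [NormedSpace ℝ F]
  (E : M → Type*) [TopologicalSpace (TotalSpace F E)] [∀ x, TopologicalSpace (E x)]
  [FiberBundle F E]

/-- `Γ(E)`: the smooth sections of `E`. -/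
abbrev Sec := Cₛ^∞⟮𝓡 m; F, E⟯

variable {m F E} [∀ x, AddCommGroup (E x)] [∀ x, Module ℝ (E x)] [VectorBundle ℝ F E]

/-- The product of a smooth function and a smooth section. -/
def fsmul (f : C^∞⟮𝓡 m, M; ℝ⟯) (e : Sec m F E) : Sec m F E :=
  ⟨fun x => f x • e x, f.contMDiff.smul_section e.contMDiff⟩

@[simp] theorem fsmul_apply (f : C^∞⟮𝓡 m, M; ℝ⟯) (e : Sec m F E) (x : M) :
    fsmul f e x = f x • e x := rfl

theorem Sec.add_apply (e₁ e₂ : Sec m F E) (x : M) : (e₁ + e₂) x = e₁ x + e₂ x := rfl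

theorem Sec.sub_apply (e₁ e₂ : Sec m F E) (x : M) : (e₁ - e₂) x = e₁ x - e₂ x := rfl

theorem Sec.smul_apply (c : ℝ) (e : Sec m F E) (x : M) : (c • e) x = c • e x := rfl

/-- The directional derivative `v(f)` of a function `f` along a tangent vector `v` at `x`. -/
def dirDeriv (f : M → ℝ) (x : M) (v : TangentSpace (𝓡 m) x) : ℝ := mvfderiv (𝓡 m) f x v

/-- A bump function with support in a given neighbourhood of `x`. -/
theorem exists_bump {m : ℕ} {M : Type*} [TopologicalSpace M]
    [ChartedSpace (EuclideanSpace ℝ (Fin m)) M] [T2Space M] [IsManifold (𝓡 m) ∞ M] {x : M}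
    {U : Set M} (hU : U ∈ nhds x) : ∃ ρ : C^∞⟮𝓡 m, M; ℝ⟯, ρ x = 1 ∧ tsupport ρ ⊆ U := by
  obtain ⟨ρ, hρ, -⟩ := (SmoothBumpFunction.nhds_basis_support (I := 𝓡 m) (c := x)
    hU).mem_iff.mp Filter.univ_mem
  exact ⟨⟨ρ, ρ.contMDiff⟩, ρ.eq_one, hρ⟩

variable [T2Space M] [IsManifold (𝓡 m) ∞ M] [FiniteDimensional ℝ F]
  [ContMDiffVectorBundle ∞ F E (𝓡 m)]

/-- A section that vanishes at `x` is, after multiplication with a function `g` with `g x = 1`,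
a combination of sections whose coefficient functions vanish at `x`. -/
theorem exists_decomp (x : M) : ∃ (k : ℕ) (s : Fin k → Sec m F E) (g : C^∞⟮𝓡 m, M; ℝ⟯), g x = 1 ∧
    ∀ d : Sec m F E, ∃ f : Fin k → C^∞⟮𝓡 m, M; ℝ⟯, fsmul g d = ∑ i, fsmul (f i) (s i) ∧
      (d x = 0 → ∀ i, f i x = 0) := by
  obtain ⟨ρ, hρ, hsupp⟩ := exists_bump (m := m)
    ((trivializationAt F E x).open_baseSet.mem_nhds
      (FiberBundle.mem_baseSet_trivializationAt F E x))
  have : ContMDiffVectorBundle 1 F E (𝓡 m) := ContMDiffVectorBundle.of_le (n := ∞) (by simp)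
  set t := trivializationAt F E x
  let b := Module.finBasis ℝ F
  let s : Fin (Module.finrank ℝ F) → Sec m F E := fun i =>
    ⟨fun y => ρ y • t.localFrame b i y, ContMDiffOn.smul_section_of_tsupport
      ρ.contMDiff.contMDiffOn t.open_baseSet hsupp (t.contMDiffOn_localFrame_baseSet ∞ b i)⟩
  refine ⟨_, s, ρ * ρ, by simp [hρ], fun d => ?_⟩
  have hc (i) : ContMDiff (𝓡 m) 𝓘(ℝ, ℝ) ∞
      (fun y => ρ y * t.localFrameCoeff (𝓡 m) b i y (d y)) := by
    refine contMDiff_of_tsupport fun y hy => ?_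
    have hy' : y ∈ t.baseSet := hsupp (closure_mono (fun z hz => by
      intro h0; exact hz (by simp [h0])) hy)
    exact ρ.contMDiff.contMDiffAt.mul
      (contMDiffAt_localFrameCoeff b hy' d.contMDiff.contMDiffAt i)
  refine ⟨fun i => ⟨_, hc i⟩, ?_, fun hd i => ?_⟩
  · ext y
    by_cases hy : y ∈ t.baseSet
    · have h := t.eq_sum_localFrameCoeff_smul (I := 𝓡 m) (b := b) (s := d) hy
      have e1 : (∑ i, fsmul (⟨_, hc i⟩ : C^∞⟮𝓡 m, M; ℝ⟯) (s i)) y =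
          ∑ i, (ρ y * t.localFrameCoeff (𝓡 m) b i y (d y)) • (ρ y • t.localFrame b i y) := by
        rw [← ContMDiffSection.coeAddHom_apply, map_sum, Finset.sum_apply]
        rfl
      rw [e1, fsmul_apply]
      conv_lhs => rw [h]
      rw [Finset.smul_sum]
      refine Finset.sum_congr rfl fun i _ => ?_
      simp only [ContMDiffMap.coe_mul, Pi.mul_apply, smul_smul]
      congr 1
      ring
    · have h0 : ρ y = 0 := image_eq_zero_of_notMem_tsupport fun h => hy (hsupp h)
      have e1 : (∑ i, fsmul (⟨_, hc i⟩ : C^∞⟮𝓡 m, M; ℝ⟯) (s i)) y =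
          ∑ i, (ρ y * t.localFrameCoeff (𝓡 m) b i y (d y)) • (ρ y • t.localFrame b i y) := by
        rw [← ContMDiffSection.coeAddHom_apply, map_sum, Finset.sum_apply]
        rfl
      rw [e1, fsmul_apply]
      simp [h0]
  · change ρ x * t.localFrameCoeff (𝓡 m) b i x (d x) = 0
    simp [hd]

/-- Every vector is the value of a global smooth section. -/
theorem exists_sec (x : M) (v : E x) : ∃ e : Sec m F E, e x = v := by
  obtain ⟨ρ, hρ, hsupp⟩ := exists_bump (m := m)
    ((trivializationAt F E x).open_baseSet.mem_nhds
      (FiberBundle.mem_baseSet_trivializationAt F E x))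
  have : ContMDiffVectorBundle 1 F E (𝓡 m) := ContMDiffVectorBundle.of_le (n := ∞) (by simp)
  set t := trivializationAt F E x
  let b := Module.finBasis ℝ F
  let s : Fin (Module.finrank ℝ F) → Sec m F E := fun i =>
    ⟨fun y => ρ y • t.localFrame b i y, ContMDiffOn.smul_section_of_tsupport
      ρ.contMDiff.contMDiffOn t.open_baseSet hsupp (t.contMDiffOn_localFrame_baseSet ∞ b i)⟩
  have hx : x ∈ t.baseSet := FiberBundle.mem_baseSet_trivializationAt F E x
  classical
  have h := t.eq_sum_localFrameCoeff_smul (I := 𝓡 m) (b := b)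
    (s := Function.update (0 : ∀ y, E y) x v) hx
  simp only [Function.update_self] at h
  refine ⟨∑ i, t.localFrameCoeff (𝓡 m) b i x v • s i, ?_⟩
  rw [← ContMDiffSection.coeAddHom_apply, map_sum, Finset.sum_apply]
  conv_rhs => rw [h]
  refine Finset.sum_congr rfl fun i _ => ?_
  change t.localFrameCoeff (𝓡 m) b i x v • (ρ x • t.localFrame b i x) = _
  rw [hρ, one_smul]

/-- An additive map on sections that is `C^∞(M)`-linear at `x` is given by a linear map on the
fibre over `x`. -/
theorem exists_fibreMap {A : Type*} [AddCommGroup A] [Module ℝ A] (x : M) (Φ : Sec m F E → A)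
    (hadd : ∀ d d', Φ (d + d') = Φ d + Φ d') (hsmul : ∀ f d, Φ (fsmul f d) = f x • Φ d) :
    ∃ L : E x →ₗ[ℝ] A, ∀ d : Sec m F E, L (d x) = Φ d := by
  have hc (c : ℝ) (d) : Φ (c • d) = c • Φ d := by
    have h := hsmul (ContMDiffMap.const c) d
    have h1 : fsmul (ContMDiffMap.const c) d = c • d := by ext y; rfl
    rw [h1] at h
    exact h
  let Ψ : Sec m F E →ₗ[ℝ] A := { toFun := Φ, map_add' := hadd, map_smul' := hc }
  have hzero (d : Sec m F E) (hd : d x = 0) : Φ d = 0 := by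
    obtain ⟨k, s, g, hg, h⟩ := exists_decomp (m := m) (F := F) (E := E) x
    obtain ⟨f, hf, hf0⟩ := h d
    have h1 : Φ (fsmul g d) = Φ d := by rw [hsmul, hg, one_smul]
    rw [← h1, hf]
    change Ψ _ = 0
    rw [map_sum]
    refine Finset.sum_eq_zero fun i _ => ?_
    change Φ _ = 0
    rw [hsmul, hf0 hd i, zero_smul]
  have hval (d d' : Sec m F E) (h : d x = d' x) : Φ d = Φ d' := by
    have h1 := hzero (d - d') (by rw [Sec.sub_apply, h, sub_self])
    have h2 : Ψ (d - d') = Ψ d - Ψ d' := map_sub _ _ _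
    exact sub_eq_zero.mp (h2.symm.trans h1)
  choose σ hσ using exists_sec (m := m) (F := F) (E := E) x
  refine ⟨{ toFun := fun v => Φ (σ v), map_add' := fun v w => ?_, map_smul' := fun c v => ?_ },
    fun d => hval _ _ (hσ _)⟩
  · rw [← hadd]
    exact hval _ _ (by rw [hσ, Sec.add_apply, hσ, hσ])
  · rw [RingHom.id_apply, ← hc]
    exact hval _ _ (by rw [hσ, Sec.smul_apply, hσ])

/-- The linear map on the fibre over `x` that represents a map on sections that is
`C^∞(M)`-linear at `x`. -/
def fibreMap {A : Type*} [AddCommGroup A] [Module ℝ A] (x : M) (Φ : Sec m F E → A)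
    (hadd : ∀ d d', Φ (d + d') = Φ d + Φ d') (hsmul : ∀ f d, Φ (fsmul f d) = f x • Φ d) :
    E x →ₗ[ℝ] A := (exists_fibreMap x Φ hadd hsmul).choose

theorem fibreMap_apply {A : Type*} [AddCommGroup A] [Module ℝ A] (x : M) (Φ : Sec m F E → A)
    (hadd : ∀ d d', Φ (d + d') = Φ d + Φ d') (hsmul : ∀ f d, Φ (fsmul f d) = f x • Φ d)
    (d : Sec m F E) : fibreMap x Φ hadd hsmul (d x) = Φ d :=
  (exists_fibreMap x Φ hadd hsmul).choose_spec d

end Sections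

/-! ## Courant algebroids, generalized connections, generalized metrics -/

section Courant

variable (m : ℕ) {M : Type*} [TopologicalSpace M] [ChartedSpace (EuclideanSpace ℝ (Fin m)) M]
  [IsManifold (𝓡 m) ∞ M]
  (F : Type*) [NormedAddCommGroup F] [NormedSpace ℝ F]
  (E : M → Type*) [TopologicalSpace (TotalSpace F E)] [∀ x, TopologicalSpace (E x)]
  [FiberBundle F E] [∀ x, AddCommGroup (E x)] [∀ x, Module ℝ (E x)] [VectorBundle ℝ F E]

/-- A Courant algebroid structure on the vector bundle `E → M`: a smooth fibrewise nondegenerate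
symmetric pairing, a bracket on `Γ(E)`, and a smooth anchor `π : E → TM`. -/
structure CourantAlgebroid where
  pairing : ∀ x, LinearMap.BilinForm ℝ (E x)
  pairing_symm : ∀ x v w, pairing x v w = pairing x w v
  pairing_nondeg : ∀ x v, (∀ w, pairing x v w = 0) → v = 0
  pairing_smooth : ∀ e₁ e₂ : Sec m F E,
    ContMDiff (𝓡 m) 𝓘(ℝ, ℝ) ∞ fun x => pairing x (e₁ x) (e₂ x)
  anchor : ∀ x, E x →ₗ[ℝ] TangentSpace (𝓡 m) x
  anchor_smooth : ∀ e : Sec m F E,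
    ContMDiff (𝓡 m) (𝓡 m).tangent ∞ fun x => (⟨x, anchor x (e x)⟩ : TangentBundle (𝓡 m) M)
  bracket : Sec m F E →ₗ[ℝ] Sec m F E →ₗ[ℝ] Sec m F E
  jacobi : ∀ e₁ e₂ e₃,
    bracket e₁ (bracket e₂ e₃) = bracket (bracket e₁ e₂) e₃ + bracket e₂ (bracket e₁ e₃)
  anchor_bracket : ∀ e₁ e₂ x, anchor x (bracket e₁ e₂ x) =
    VectorField.mlieBracket (𝓡 m) (fun y => anchor y (e₁ y)) (fun y => anchor y (e₂ y)) x
  bracket_fsmul : ∀ (e₁ e₂ : Sec m F E) (f : C^∞⟮𝓡 m, M; ℝ⟯) x,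
    bracket e₁ (fsmul f e₂) x =
      dirDeriv f x (anchor x (e₁ x)) • e₂ x + f x • bracket e₁ e₂ x
  anchor_pairing : ∀ (e₁ e₂ e₃ : Sec m F E) x,
    dirDeriv (fun y => pairing y (e₂ y) (e₃ y)) x (anchor x (e₁ x)) =
      pairing x (bracket e₁ e₂ x) (e₃ x) + pairing x (e₂ x) (bracket e₁ e₃ x)
  /-- `2[e,e] = π^* d⟨e,e⟩`, with `E ≅ E^*` through the pairing. -/
  bracket_self : ∀ (e : Sec m F E) x (v : E x), 2 * pairing x (bracket e e x) v =
    dirDeriv (fun y => pairing y (e y) (e y)) x (anchor x v)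

variable {m F E} (C : CourantAlgebroid m F E)

variable {C} in
/-- The bracket of pointwise orthogonal sections is skew-symmetric. -/
theorem CourantAlgebroid.bracket_swap (d e : Sec m F E)
    (h : ∀ y, C.pairing y (d y) (e y) = 0) (x : M) :
    C.bracket d e x = -C.bracket e d x := by
  rw [← sub_eq_zero, sub_neg_eq_add]
  refine C.pairing_nondeg x _ fun w => ?_
  have hs := C.bracket_self (d + e) x w
  have hfun : (fun y => C.pairing y ((d + e) y) ((d + e) y)) =
      (fun y => C.pairing y (d y) (d y)) + fun y => C.pairing y (e y) (e y) := by
    funext y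
    simp only [Sec.add_apply, _root_.map_add, LinearMap.add_apply, Pi.add_apply, h,
      C.pairing_symm y (e y) (d y)]
    ring
  have hd : MDifferentiableAt (𝓡 m) 𝓘(ℝ, ℝ) (fun y => C.pairing y (d y) (d y)) x :=
    (C.pairing_smooth d d).mdifferentiable (by simp) x
  have he : MDifferentiableAt (𝓡 m) 𝓘(ℝ, ℝ) (fun y => C.pairing y (e y) (e y)) x :=
    (C.pairing_smooth e e).mdifferentiable (by simp) x
  have hsum : dirDeriv (fun y => C.pairing y ((d + e) y) ((d + e) y)) x (C.anchor x w) =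
      dirDeriv (fun y => C.pairing y (d y) (d y)) x (C.anchor x w) +
        dirDeriv (fun y => C.pairing y (e y) (e y)) x (C.anchor x w) := by
    rw [hfun]
    unfold dirDeriv
    rw [mvfderiv_add hd he]
    rfl
  rw [hsum, ← C.bracket_self d x w, ← C.bracket_self e x w] at hs
  simp only [_root_.map_add, LinearMap.add_apply, Sec.add_apply] at hs ⊢
  linarith

theorem CourantAlgebroid.bracket_fsmul_left (f : C^∞⟮𝓡 m, M; ℝ⟯) (d e : Sec m F E) (x : M)
    (h : ∀ y, C.pairing y (d y) (e y) = 0) :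
    C.bracket (fsmul f d) e x =
      -(dirDeriv f x (C.anchor x (e x)) • d x) + f x • C.bracket d e x := by
  rw [bracket_swap (fsmul f d) e (fun y => by simp [h]), C.bracket_fsmul, bracket_swap d e h]
  module

/-- A generalized connection: `D.nabla e x v` is `(D_v e)(x)`, so that `D.nabla e` is the section
`D e` of `E^* ⊗ E`. -/
structure GeneralizedConnection where
  nabla : Sec m F E → ∀ x, E x →ₗ[ℝ] E x
  smooth : ∀ e₁ e₂ : Sec m F E, ContMDiff (𝓡 m) ((𝓡 m).prod 𝓘(ℝ, F)) ∞
    fun x => TotalSpace.mk' F x (nabla e₂ x (e₁ x))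
  map_add : ∀ e₁ e₂ x, nabla (e₁ + e₂) x = nabla e₁ x + nabla e₂ x
  leibniz : ∀ (f : C^∞⟮𝓡 m, M; ℝ⟯) (e : Sec m F E) x v,
    nabla (fsmul f e) x v = dirDeriv f x (C.anchor x v) • e x + f x • nabla e x v
  metric : ∀ (e₁ e₂ : Sec m F E) x v,
    dirDeriv (fun y => C.pairing y (e₁ y) (e₂ y)) x (C.anchor x v) =
      C.pairing x (nabla e₁ x v) (e₂ x) + C.pairing x (e₁ x) (nabla e₂ x v)

/-- A divergence operator `div : Γ(E) → C^∞(M)`. -/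
structure DivergenceOperator where
  toFun : Sec m F E → C^∞⟮𝓡 m, M; ℝ⟯
  map_add : ∀ e₁ e₂, toFun (e₁ + e₂) = toFun e₁ + toFun e₂
  leibniz : ∀ (f : C^∞⟮𝓡 m, M; ℝ⟯) (e : Sec m F E) x,
    toFun (fsmul f e) x = dirDeriv f x (C.anchor x (e x)) + f x * toFun e x

/-- A generalized metric, given by the smooth symmetric endomorphism `G` of `E` with `G² = Id`
whose `±1`-eigenbundles are `V_±`. -/
structure GeneralizedMetric where
  G : ∀ x, E x →ₗ[ℝ] E x
  smooth : ∀ e : Sec m F E, ContMDiff (𝓡 m) ((𝓡 m).prod 𝓘(ℝ, F)) ∞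
    fun x => TotalSpace.mk' F x (G x (e x))
  sq : ∀ x v, G x (G x v) = v
  symm : ∀ x v w, C.pairing x (G x v) w = C.pairing x v (G x w)

namespace GeneralizedConnection

variable {C} (D : GeneralizedConnection C)

/-- The section `D_{e₁} e₂`. -/
def cov (e₁ e₂ : Sec m F E) : Sec m F E := ⟨fun x => D.nabla e₂ x (e₁ x), D.smooth e₁ e₂⟩

/-- The torsion `T_D(e₁,e₂,e₃)`. -/
def torsion (e₁ e₂ e₃ : Sec m F E) (x : M) : ℝ :=
  C.pairing x ((D.cov e₁ e₂ - D.cov e₂ e₁ - C.bracket e₁ e₂) x) (e₃ x) +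
    C.pairing x (D.cov e₃ e₁ x) (e₂ x)

/-- The divergence `div_D(e) = tr (D e)`. -/
def divergence (e : Sec m F E) (x : M) : ℝ := LinearMap.trace ℝ (E x) (D.nabla e x)

/-- The expression `D_{e₁} D_{e₂} e₃ - D_{e₂} D_{e₁} e₃ - D_{[e₁,e₂]} e₃`. -/
def curv (e₁ e₂ e₃ : Sec m F E) : Sec m F E :=
  D.cov e₁ (D.cov e₂ e₃) - D.cov e₂ (D.cov e₁ e₃) - D.cov (C.bracket e₁ e₂) e₃

theorem curv_add_left (d d' e₁ e₂ : Sec m F E) (x : M) (d'' : Sec m F E) (h : d'' = d + d') :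
    D.curv d'' e₁ e₂ x = D.curv d e₁ e₂ x + D.curv d' e₁ e₂ x := by
  subst h
  have h1 (a : Sec m F E) : D.cov (d + d') a = D.cov d a + D.cov d' a := by
    ext y
    exact (D.nabla a y).map_add _ _
  have h2 (a b b' : Sec m F E) : D.cov a (b + b') x = D.cov a b x + D.cov a b' x := by
    change D.nabla (b + b') x (a x) = _
    rw [D.map_add]
    rfl
  have h3 (a b : Sec m F E) : D.cov (a + b) e₂ x = D.cov a e₂ x + D.cov b e₂ x :=
    (D.nabla e₂ x).map_add _ _
  simp only [curv, Sec.sub_apply, h1, h2, _root_.map_add, LinearMap.add_apply, h3, Sec.add_apply]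
  abel

theorem curv_fsmul_left (f : C^∞⟮𝓡 m, M; ℝ⟯) (d e₁ e₂ : Sec m F E) (x : M)
    (h : ∀ y, C.pairing y (d y) (e₁ y) = 0) :
    D.curv (fsmul f d) e₁ e₂ x = f x • D.curv d e₁ e₂ x := by
  have h1 (a : Sec m F E) : D.cov (fsmul f d) a = fsmul f (D.cov d a) := by
    ext y
    exact (D.nabla a y).map_smul _ _
  have h2 : D.cov e₁ (fsmul f (D.cov d e₂)) x =
      dirDeriv f x (C.anchor x (e₁ x)) • D.cov d e₂ x + f x • D.cov e₁ (D.cov d e₂) x :=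
    D.leibniz _ _ _ _
  have h3 : D.cov (C.bracket (fsmul f d) e₁) e₂ x =
      -(dirDeriv f x (C.anchor x (e₁ x)) • D.cov d e₂ x) +
        f x • D.cov (C.bracket d e₁) e₂ x := by
    change D.nabla e₂ x (C.bracket (fsmul f d) e₁ x) = _
    rw [C.bracket_fsmul_left f d e₁ x h, _root_.map_add, map_neg, _root_.map_smul,
      _root_.map_smul]
    rfl
  simp only [curv, Sec.sub_apply, h1, h2, h3, fsmul_apply]
  module

end GeneralizedConnection

namespace GeneralizedMetric

variable {C} (V : GeneralizedMetric C)

/-- The subbundle `V_s`, for a sign `s = ±1`: the `s`-eigenbundle of `G`. -/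
def sub (s : ℤˣ) (x : M) : Submodule ℝ (E x) :=
  LinearMap.ker (((s : ℤ) : ℝ) • LinearMap.id - V.G x)

theorem mem_sub {s : ℤˣ} {x : M} {v : E x} : v ∈ V.sub s x ↔ V.G x v = ((s : ℤ) : ℝ) • v := by
  rw [sub, LinearMap.mem_ker, LinearMap.sub_apply, sub_eq_zero, eq_comm]
  rfl

/-- The orthogonal projection `E → V_s`, `e ↦ e^s = (e + s G e) / 2`. -/
def proj (s : ℤˣ) (x : M) : E x →ₗ[ℝ] E x :=
  (1 / 2 : ℝ) • (LinearMap.id + ((s : ℤ) : ℝ) • V.G x)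

theorem sign_mul_self (s : ℤˣ) : ((s : ℤ) : ℝ) * ((s : ℤ) : ℝ) = 1 := by
  rcases Int.units_eq_one_or s with rfl | rfl <;> simp

theorem proj_mem (s : ℤˣ) (x : M) (v : E x) : V.proj s x v ∈ V.sub s x := by
  rw [mem_sub]
  simp only [proj, LinearMap.smul_apply, LinearMap.add_apply, LinearMap.id_apply, _root_.map_smul,
    _root_.map_add, V.sq]
  rw [smul_comm ((s : ℤ) : ℝ) (1 / 2 : ℝ) (v + _), smul_add ((s : ℤ) : ℝ),
    smul_smul ((s : ℤ) : ℝ) ((s : ℤ) : ℝ), sign_mul_self]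
  module

theorem pairing_proj (s : ℤˣ) (x : M) (v w : E x) :
    C.pairing x (V.proj s x v) (V.proj (-s) x w) = 0 := by
  have h := V.symm x v w
  have h2 : C.pairing x (V.G x v) (V.G x w) = C.pairing x v w := by rw [V.symm, V.sq]
  rcases Int.units_eq_one_or s with rfl | rfl <;>
    simp [proj, h, h2] <;> ring

/-- The section `e^s` of `V_s`. -/
def projSec (s : ℤˣ) (e : Sec m F E) : Sec m F E :=
  ⟨fun x => V.proj s x (e x), by
    have h := ((e.contMDiff.add_section
      ((V.smooth e).const_smul_section (a := ((s : ℤ) : ℝ)))).const_smul_section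
        (a := (1 / 2 : ℝ)))
    exact h⟩

theorem projSec_add (s : ℤˣ) (d d' : Sec m F E) :
    V.projSec s (d + d') = V.projSec s d + V.projSec s d' := by
  ext x
  exact (V.proj s x).map_add _ _

theorem projSec_fsmul (s : ℤˣ) (f : C^∞⟮𝓡 m, M; ℝ⟯) (d : Sec m F E) :
    V.projSec s (fsmul f d) = fsmul f (V.projSec s d) := by
  ext x
  exact (V.proj s x).map_smul _ _

theorem proj_eq {s : ℤˣ} {x : M} {v : E x} (hv : v ∈ V.sub s x) : V.proj s x v = v := by
  rw [mem_sub] at hv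
  simp only [proj, LinearMap.smul_apply, LinearMap.add_apply, LinearMap.id_apply, hv]
  rw [smul_smul, sign_mul_self, one_smul, ← two_smul ℝ v, smul_smul]
  norm_num

theorem projSec_eq {s : ℤˣ} {e : Sec m F E} (he : ∀ x, e x ∈ V.sub s x) : V.projSec s e = e := by
  ext x
  exact V.proj_eq (he x)

/-- The generalized connection `D` is compatible with the generalized metric:
`D(Γ(V_±)) ⊂ Γ(E^* ⊗ V_±)`. -/
def Compatible (D : GeneralizedConnection C) : Prop :=
  ∀ (s : ℤˣ) (e : Sec m F E), (∀ x, e x ∈ V.sub s x) → ∀ x v, D.nabla e x v ∈ V.sub s x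

/-- The set `𝓓(V_+, div)` of torsion-free generalized connections that are compatible with the
generalized metric and have divergence `div`. -/
def leviCivita (dv : DivergenceOperator C) : Set (GeneralizedConnection C) :=
  {D | V.Compatible D ∧ (∀ e₁ e₂ e₃ x, D.torsion e₁ e₂ e₃ x = 0) ∧
    ∀ e x, D.divergence e x = dv.toFun e x}

theorem curv_mem {D : GeneralizedConnection C} (hD : V.Compatible D) {s : ℤˣ}
    {d e₁ e₂ : Sec m F E} (h₂ : ∀ x, e₂ x ∈ V.sub s x) (x : M) :
    D.curv d e₁ e₂ x ∈ V.sub s x := by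
  have h (a b : Sec m F E) (hb : ∀ x, b x ∈ V.sub s x) : ∀ x, D.cov a b x ∈ V.sub s x :=
    fun x => hD s b hb x _
  exact Submodule.sub_mem _ (Submodule.sub_mem _ (h _ _ (h _ _ h₂) x) (h _ _ (h _ _ h₂) x))
    (h _ _ h₂ x)

/-- For fixed `e₁, e₂`, the assignment `d ↦ (R_D^s(d^s, e₁^{-s}) e₂^s)(x)` is additive. -/
theorem curv_add (D : GeneralizedConnection C) (s : ℤˣ) (e₁ e₂ : Sec m F E) (x : M)
    (d d' : Sec m F E) :
    D.curv (V.projSec s (d + d')) (V.projSec (-s) e₁) (V.projSec s e₂) x =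
      D.curv (V.projSec s d) (V.projSec (-s) e₁) (V.projSec s e₂) x +
        D.curv (V.projSec s d') (V.projSec (-s) e₁) (V.projSec s e₂) x :=
  D.curv_add_left _ _ _ _ _ _ (V.projSec_add s d d')

/-- For fixed `e₁, e₂`, the assignment `d ↦ (R_D^s(d^s, e₁^{-s}) e₂^s)(x)` is
`C^∞(M)`-linear. -/
theorem curv_fsmul (D : GeneralizedConnection C) (s : ℤˣ) (e₁ e₂ : Sec m F E) (x : M)
    (f : C^∞⟮𝓡 m, M; ℝ⟯) (d : Sec m F E) :
    D.curv (V.projSec s (fsmul f d)) (V.projSec (-s) e₁) (V.projSec s e₂) x =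
      f x • D.curv (V.projSec s d) (V.projSec (-s) e₁) (V.projSec s e₂) x := by
  rw [projSec_fsmul]
  exact D.curv_fsmul_left _ _ _ _ _ fun y => V.pairing_proj s y _ _

variable [T2Space M] [FiniteDimensional ℝ F] [ContMDiffVectorBundle ∞ F E (𝓡 m)]

/-- The endomorphism `d ↦ R_D^s(d, e₁^{-s}) e₂^s` of the fibre of `V_s` over `x`, where
`R_D^s ∈ Γ(V_s^* ⊗ V_{-s}^* ⊗ 𝔬(V_s))` is the curvature of `D`. For `D` compatible with the
generalized metric the final projection to `V_s` does nothing. -/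
def curvEnd (s : ℤˣ) (D : GeneralizedConnection C) (e₁ e₂ : Sec m F E) (x : M) :
    V.sub s x →ₗ[ℝ] V.sub s x :=
  (V.proj s x).codRestrict (V.sub s x) (V.proj_mem s x) ∘ₗ
    fibreMap x (fun d => D.curv (V.projSec s d) (V.projSec (-s) e₁) (V.projSec s e₂) x)
      (V.curv_add D s e₁ e₂ x) (V.curv_fsmul D s e₁ e₂ x) ∘ₗ (V.sub s x).subtype

/-- The endomorphism `curvEnd` is the one given by the curvature. -/
theorem curvEnd_apply (s : ℤˣ) (D : GeneralizedConnection C) (hD : V.Compatible D)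
    (d e₁ e₂ : Sec m F E) (hd : ∀ x, d x ∈ V.sub s x) (h₁ : ∀ x, e₁ x ∈ V.sub (-s) x)
    (h₂ : ∀ x, e₂ x ∈ V.sub s x) (x : M) :
    (V.curvEnd s D e₁ e₂ x ⟨d x, hd x⟩ : E x) = D.curv d e₁ e₂ x := by
  have key := fibreMap_apply x
    (fun d => D.curv (V.projSec s d) (V.projSec (-s) e₁) (V.projSec s e₂) x)
    (V.curv_add D s e₁ e₂ x) (V.curv_fsmul D s e₁ e₂ x) d
  change V.proj s x (fibreMap x _ _ _ (d x)) = _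
  rw [key]
  simp only [V.projSec_eq hd, V.projSec_eq h₁, V.projSec_eq h₂]
  apply V.proj_eq
  exact V.curv_mem hD h₂ x

/-- The Ricci tensor `Ric_D^s ∈ Γ(V_{-s}^* ⊗ V_s^*)`, `s = ±1`, as the function
`Ric_D^s(e₁^{-s}, e₂^s) = tr (d ↦ R_D^s(d, e₁^{-s}) e₂^s)`, the trace being taken over `V_s`. -/
def ricci (s : ℤˣ) (D : GeneralizedConnection C) (e₁ e₂ : Sec m F E) (x : M) : ℝ :=
  LinearMap.trace ℝ (V.sub s x) (V.curvEnd s D e₁ e₂ x)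

end GeneralizedMetric

end Courant

/-! ## Equivariant Courant algebroids and their simple reductions -/

section Equivariant

variable (k m n : ℕ)
  (T : Type*) [TopologicalSpace T] [ChartedSpace (EuclideanSpace ℝ (Fin k)) T] [CommGroup T]
  {M : Type*} [TopologicalSpace M] [ChartedSpace (EuclideanSpace ℝ (Fin m)) M]
  [MulAction T M]
  (B : Type*) [TopologicalSpace B] [ChartedSpace (EuclideanSpace ℝ (Fin n)) B]

variable (M) in
/-- `M` is a smooth principal `T`-bundle over `B = M/T`: the action is free, the fibres of the
projection `M → B` are the orbits, and over small open sets `U` of `B` there are a smooth section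
`σ` and a smooth fibre coordinate `τ`, that is, the map `(u, t) ↦ t • σ u` is an equivariant
diffeomorphism from `U × T` onto the preimage of `U`, with inverse `(proj, τ)`. -/
structure PrincipalBundle where
  proj : M → B
  smooth : ContMDiff (𝓡 m) (𝓡 n) ∞ proj
  free : ∀ (t : T) (x : M), t • x = x → t = 1
  fibre : ∀ x y : M, proj x = proj y ↔ ∃ t : T, t • x = y
  locally_trivial : ∀ b : B, ∃ (U : Set B) (σ : B → M) (τ : M → T), IsOpen U ∧ b ∈ U ∧
    ContMDiffOn (𝓡 n) (𝓡 m) ∞ σ U ∧ (∀ u ∈ U, proj (σ u) = u) ∧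
    ContMDiffOn (𝓡 m) (𝓡 k) ∞ τ (proj ⁻¹' U) ∧ ∀ x, proj x ∈ U → τ x • σ (proj x) = x

variable {k m n T B}

theorem PrincipalBundle.proj_smul (P : PrincipalBundle k m n T M B) (t : T) (x : M) :
    P.proj (t • x) = P.proj x := ((P.fibre x (t • x)).mpr ⟨t, rfl⟩).symm

theorem PrincipalBundle.surjective (P : PrincipalBundle k m n T M B) :
    Function.Surjective P.proj := fun b => by
  obtain ⟨U, σ, -, -, hb, -, hσ, -⟩ := P.locally_trivial b
  exact ⟨σ b, hσ b hb⟩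

/-- A point of the fibre over `b`. -/
def PrincipalBundle.pt (P : PrincipalBundle k m n T M B) (b : B) : {x // P.proj x = b} :=
  ⟨(P.surjective b).choose, (P.surjective b).choose_spec⟩

variable [IsManifold (𝓡 m) ∞ M]
  (F : Type*) [NormedAddCommGroup F] [NormedSpace ℝ F]
  (E : M → Type*) [TopologicalSpace (TotalSpace F E)] [∀ x, TopologicalSpace (E x)]
  [FiberBundle F E] [∀ x, AddCommGroup (E x)] [∀ x, Module ℝ (E x)] [VectorBundle ℝ F E]

variable (k m n T B) in
/-- An equivariant Courant algebroid `(E, M, T)` with base `B`: a Courant algebroid `E` over a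
principal `T`-bundle `M → B`, with a smooth lift of the `T`-action on `M` to an action on `E` by
linear maps between the fibres, which preserves the pairing, the anchor and the bracket. -/
structure EquivariantCourantAlgebroid where
  courant : CourantAlgebroid m F E
  bundle : PrincipalBundle k m n T M B
  act : ∀ (t : T) (x : M), E x →ₗ[ℝ] E (t • x)
  act_one : ∀ x v, TotalSpace.mk' F ((1 : T) • x) (act 1 x v) = TotalSpace.mk' F x v
  act_mul : ∀ s t x v, TotalSpace.mk' F ((s * t) • x) (act (s * t) x v) =
    TotalSpace.mk' F (s • t • x) (act s (t • x) (act t x v))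
  act_smooth : ContMDiff ((𝓡 k).prod ((𝓡 m).prod 𝓘(ℝ, F))) ((𝓡 m).prod 𝓘(ℝ, F)) ∞
    fun q : T × TotalSpace F E => TotalSpace.mk' F (q.1 • q.2.proj) (act q.1 q.2.proj q.2.snd)
  pairing_act : ∀ t x v w,
    courant.pairing (t • x) (act t x v) (act t x w) = courant.pairing x v w
  anchor_act : ∀ t x v, courant.anchor (t • x) (act t x v) =
    mfderiv (𝓡 m) (𝓡 m) (fun y : M => t • y) x (courant.anchor x v)
  /-- If `t` carries the sections `e₁, e₂` to `a₁, a₂`, it carries `[e₁, e₂]` to `[a₁, a₂]`. -/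
  bracket_act : ∀ (t : T) (e₁ e₂ a₁ a₂ : Sec m F E),
    (∀ x, a₁ (t • x) = act t x (e₁ x)) → (∀ x, a₂ (t • x) = act t x (e₂ x)) →
    ∀ x, courant.bracket a₁ a₂ (t • x) = act t x (courant.bracket e₁ e₂ x)

namespace EquivariantCourantAlgebroid

variable {F E} (𝓔 : EquivariantCourantAlgebroid k m n T B F E)

/-- The sections of the simple reduction: `Γ(E/T) = Γ(E)^T`. -/
def redSec : Submodule ℝ (Sec m F E) where
  carrier := {e | ∀ (t : T) x, e (t • x) = 𝓔.act t x (e x)}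
  add_mem' {e e'} h h' t x := by
    rw [Sec.add_apply, Sec.add_apply, h, h', map_add]
  zero_mem' t x := ((𝓔.act t x).map_zero).symm
  smul_mem' c e h t x := by
    rw [Sec.smul_apply, Sec.smul_apply, h, map_smul]

/-- The fibre `(E/T)_b` of the simple reduction `E/T → B`: an element is a `T`-orbit in the
restriction of `E` to the fibre of `M` over `b`, that is, an invariant section of that
restriction. -/
def redFibre (b : B) : Submodule ℝ (∀ x : {x // 𝓔.bundle.proj x = b}, E x.1) where
  carrier := {v | ∀ (t : T) (x : {x // 𝓔.bundle.proj x = b}),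
    v ⟨t • x.1, (𝓔.bundle.proj_smul t x.1).trans x.2⟩ = 𝓔.act t x.1 (v x)}
  add_mem' {v w} h h' t x := by
    simp only [Pi.add_apply, h t x, h' t x, map_add]
  zero_mem' t x := ((𝓔.act t x.1).map_zero).symm
  smul_mem' c v h t x := by
    simp only [Pi.smul_apply, h t x, map_smul]

/-- The representative in `E_x` of an element of `(E/T)_b`, for `x` in the fibre over `b`. -/
def rep (b : B) (x : {x // 𝓔.bundle.proj x = b}) : 𝓔.redFibre b →ₗ[ℝ] E x.1 :=
  LinearMap.proj x ∘ₗ (𝓔.redFibre b).subtype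

theorem rep_smul (b : B) (v : 𝓔.redFibre b) (t : T) (x : {x // 𝓔.bundle.proj x = b}) :
    𝓔.rep b ⟨t • x.1, (𝓔.bundle.proj_smul t x.1).trans x.2⟩ v = 𝓔.act t x.1 (𝓔.rep b x v) :=
  v.2 t x

/-- The value at `b` of a section of `E/T`. -/
def value (b : B) : 𝓔.redSec →ₗ[ℝ] 𝓔.redFibre b where
  toFun e := ⟨fun x => e.1 x.1, fun t x => e.2 t x.1⟩
  map_add' _ _ := rfl
  map_smul' _ _ := rfl

theorem rep_value (b : B) (x : {x // 𝓔.bundle.proj x = b}) (e : 𝓔.redSec) :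
    𝓔.rep b x (𝓔.value b e) = e.1 x.1 := rfl

/-- The pairing of `E/T`, computed on representatives. -/
def redPairing (b : B) : LinearMap.BilinForm ℝ (𝓔.redFibre b) :=
  (𝓔.courant.pairing (𝓔.bundle.pt b).1).compl₁₂
    (𝓔.rep b (𝓔.bundle.pt b)) (𝓔.rep b (𝓔.bundle.pt b))

/-- The pairing of `E/T` does not depend on the representatives. -/
theorem redPairing_apply (b : B) (v w : 𝓔.redFibre b) (x : {x // 𝓔.bundle.proj x = b}) :
    𝓔.redPairing b v w = 𝓔.courant.pairing x.1 (𝓔.rep b x v) (𝓔.rep b x w) := by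
  obtain ⟨t, ht⟩ := (𝓔.bundle.fibre x.1 (𝓔.bundle.pt b).1).mp (x.2.trans (𝓔.bundle.pt b).2.symm)
  have hpt : 𝓔.bundle.pt b = ⟨t • x.1, (𝓔.bundle.proj_smul t x.1).trans x.2⟩ :=
    Subtype.ext ht.symm
  change 𝓔.courant.pairing (𝓔.bundle.pt b).1 (𝓔.rep b (𝓔.bundle.pt b) v)
    (𝓔.rep b (𝓔.bundle.pt b) w) = _
  rw [hpt, rep_smul, rep_smul, 𝓔.pairing_act]

/-- The vector `dp(π(v))` in the tangent space of the base, for `v ∈ E_x`; tangent spaces of `B`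
are copies of the model space. -/
def baseAnchor (x : M) : E x →ₗ[ℝ] EuclideanSpace ℝ (Fin n) :=
  (mfderiv (𝓡 m) (𝓡 n) 𝓔.bundle.proj x).toLinearMap ∘ₗ 𝓔.courant.anchor x

/-- The anchor of `E/T`, induced by the anchor of `E` and the differential of `M → B`. -/
def redAnchor (b : B) : 𝓔.redFibre b →ₗ[ℝ] TangentSpace (𝓡 n) b :=
  𝓔.baseAnchor (𝓔.bundle.pt b).1 ∘ₗ 𝓔.rep b (𝓔.bundle.pt b)

/-- The anchor of `E/T` does not depend on the representatives. -/
theorem redAnchor_apply [ContMDiffSMul (𝓡 k) (𝓡 m) ∞ T M] (b : B) (v : 𝓔.redFibre b)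
    (x : {x // 𝓔.bundle.proj x = b}) :
    𝓔.redAnchor b v = 𝓔.baseAnchor x.1 (𝓔.rep b x v) := by
  obtain ⟨t, ht⟩ := (𝓔.bundle.fibre x.1 (𝓔.bundle.pt b).1).mp (x.2.trans (𝓔.bundle.pt b).2.symm)
  have hpt : 𝓔.bundle.pt b = ⟨t • x.1, (𝓔.bundle.proj_smul t x.1).trans x.2⟩ :=
    Subtype.ext ht.symm
  change 𝓔.baseAnchor (𝓔.bundle.pt b).1 (𝓔.rep b (𝓔.bundle.pt b) v) = _
  rw [hpt, rep_smul]
  change mfderiv (𝓡 m) (𝓡 n) 𝓔.bundle.proj (t • x.1)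
    (𝓔.courant.anchor (t • x.1) (𝓔.act t x.1 (𝓔.rep b x v))) =
    mfderiv (𝓡 m) (𝓡 n) 𝓔.bundle.proj x.1 (𝓔.courant.anchor x.1 (𝓔.rep b x v))
  rw [𝓔.anchor_act]
  have hsm : ContMDiff (𝓡 m) (𝓡 m) ∞ fun y : M => t • y :=
    (contMDiff_smul (I := 𝓡 k) (I' := 𝓡 m) (n := ∞) (G := T) (M := M)).comp
      (contMDiff_const.prodMk contMDiff_id)
  have hcomp : 𝓔.bundle.proj ∘ (fun y : M => t • y) = 𝓔.bundle.proj :=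
    funext fun y => 𝓔.bundle.proj_smul t y
  have h := mfderiv_comp (I := 𝓡 m) (I' := 𝓡 m) (I'' := 𝓡 n) x.1
    (𝓔.bundle.smooth.mdifferentiable (by simp) (t • x.1))
    (hsm.mdifferentiable (by simp) x.1)
  rw [hcomp] at h
  rw [h]
  rfl

/-- The bracket of `E/T`: the restriction of the bracket of `E` to invariant sections. -/
def redBracket (e₁ e₂ : 𝓔.redSec) : 𝓔.redSec :=
  ⟨𝓔.courant.bracket e₁.1 e₂.1, fun t => 𝓔.bracket_act t _ _ _ _ (e₁.2 t) (e₂.2 t)⟩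

/-- The generalized metric is `T`-invariant: the action preserves `V_+`. -/
def InvariantMetric (V : GeneralizedMetric 𝓔.courant) : Prop :=
  ∀ (t : T) x, ∀ v ∈ V.sub 1 x, 𝓔.act t x v ∈ V.sub 1 (t • x)

/-- The divergence operator is `T`-invariant. -/
def InvariantDivergence (dv : DivergenceOperator 𝓔.courant) : Prop :=
  ∀ (t : T) (e a : Sec m F E), (∀ x, a (t • x) = 𝓔.act t x (e x)) →
    ∀ x, dv.toFun a (t • x) = dv.toFun e x

/-- The push-forward `p_* V_+ ⊂ E/T` of a generalized metric. -/
def pushMetric (V : GeneralizedMetric 𝓔.courant) (b : B) : Submodule ℝ (𝓔.redFibre b) :=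
  ⨅ x : {x // 𝓔.bundle.proj x = b}, (V.sub 1 x.1).comap (𝓔.rep b x)

end EquivariantCourantAlgebroid

end Equivariant

/-! ## Duality -/

section Duality

variable {k₁ k₂ m₁ m₂ n : ℕ} {B : Type*} [TopologicalSpace B]
  [ChartedSpace (EuclideanSpace ℝ (Fin n)) B]
  {T₁ : Type*} [TopologicalSpace T₁] [ChartedSpace (EuclideanSpace ℝ (Fin k₁)) T₁] [CommGroup T₁]
  {M₁ : Type*} [TopologicalSpace M₁] [ChartedSpace (EuclideanSpace ℝ (Fin m₁)) M₁]
  [IsManifold (𝓡 m₁) ∞ M₁] [MulAction T₁ M₁]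
  {F₁ : Type*} [NormedAddCommGroup F₁] [NormedSpace ℝ F₁]
  {E₁ : M₁ → Type*} [TopologicalSpace (TotalSpace F₁ E₁)] [∀ x, TopologicalSpace (E₁ x)]
  [FiberBundle F₁ E₁] [∀ x, AddCommGroup (E₁ x)] [∀ x, Module ℝ (E₁ x)] [VectorBundle ℝ F₁ E₁]
  {T₂ : Type*} [TopologicalSpace T₂] [ChartedSpace (EuclideanSpace ℝ (Fin k₂)) T₂] [CommGroup T₂]
  {M₂ : Type*} [TopologicalSpace M₂] [ChartedSpace (EuclideanSpace ℝ (Fin m₂)) M₂]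
  [IsManifold (𝓡 m₂) ∞ M₂] [MulAction T₂ M₂]
  {F₂ : Type*} [NormedAddCommGroup F₂] [NormedSpace ℝ F₂]
  {E₂ : M₂ → Type*} [TopologicalSpace (TotalSpace F₂ E₂)] [∀ x, TopologicalSpace (E₂ x)]
  [FiberBundle F₂ E₂] [∀ x, AddCommGroup (E₂ x)] [∀ x, Module ℝ (E₂ x)] [VectorBundle ℝ F₂ E₂]
  (𝓔₁ : EquivariantCourantAlgebroid k₁ m₁ n T₁ B F₁ E₁)
  (𝓔₂ : EquivariantCourantAlgebroid k₂ m₂ n T₂ B F₂ E₂)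

/-- A duality isomorphism `ψ : E₁/T₁ → E₂/T₂`: an isomorphism of Courant algebroids over `B`
between the simple reductions. It is given by linear isomorphisms between the fibres over `B` which
induce a bijection `sec` between smooth sections and preserve pairing, anchor and bracket. -/
structure DualityIso where
  fibre : ∀ b, 𝓔₁.redFibre b ≃ₗ[ℝ] 𝓔₂.redFibre b
  sec : 𝓔₁.redSec ≃ₗ[ℝ] 𝓔₂.redSec
  value_sec : ∀ e b, 𝓔₂.value b (sec e) = fibre b (𝓔₁.value b e)
  pairing : ∀ b v w, 𝓔₂.redPairing b (fibre b v) (fibre b w) = 𝓔₁.redPairing b v w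
  anchor : ∀ b v, 𝓔₂.redAnchor b (fibre b v) = 𝓔₁.redAnchor b v
  bracket : ∀ e₁ e₂, sec (𝓔₁.redBracket e₁ e₂) = 𝓔₂.redBracket (sec e₁) (sec e₂)

/-- The functions `f₁` on `M₁` and `f₂` on `M₂` are the pull-backs of one function on the common
base `B`, that is, they are invariant and their push-forwards to `B` are equal. -/
def EqualPushforward (f₁ : M₁ → ℝ) (f₂ : M₂ → ℝ) : Prop :=
  ∃ g : B → ℝ, (∀ x, f₁ x = g (𝓔₁.bundle.proj x)) ∧ ∀ x, f₂ x = g (𝓔₂.bundle.proj x)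

variable {𝓔₁ 𝓔₂}

/-- The pairs `(V₁, div₁)` and `(V₂, div₂)` are dual: `ψ(p₁_* V₁_+) = p₂_* V₂_+` and
`p₁_* div₁ = ψ^* p₂_* div₂`. -/
structure DualPairs (ψ : DualityIso 𝓔₁ 𝓔₂)
    (V₁ : GeneralizedMetric 𝓔₁.courant) (div₁ : DivergenceOperator 𝓔₁.courant)
    (V₂ : GeneralizedMetric 𝓔₂.courant) (div₂ : DivergenceOperator 𝓔₂.courant) : Prop where
  metric : ∀ b, (𝓔₁.pushMetric V₁ b).map (ψ.fibre b).toLinearMap = 𝓔₂.pushMetric V₂ b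
  divergence : ∀ e : 𝓔₁.redSec,
    EqualPushforward 𝓔₁ 𝓔₂ (div₁.toFun e.1) (div₂.toFun (ψ.sec e).1)

end Duality

end CourantGeometry

end

open CourantGeometry

noncomputable section

set_option linter.unusedSectionVars false

/-! For `D` in `leviCivita`, the Ricci tensor is a function of the bracket, the anchor, the
splitting and the divergence alone. Put a = e₁^{-s} and b = e₂^s. Vanishing torsion and
compatibility force D_a b = [a,b]^s (`nabla_mixed`). In the trace over V_s of d ↦ D_d D_a b - D_a
D_d b - D_{[d,a]} b, the first term therefore gives div([a,b]^s). Split [d,a] into components: its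
V_s part is -D_a d, and it combines with D_a D_d b to the commutator of D_a with the endomorphism
Db. The trace of that commutator is π(a)(tr Db) = π(a)(div b) (`trace_commutator`). The V_{-s} part
contributes Q(d) = [[d,a]^{-s}, b]^s, again by `nabla_mixed`. Hence Ric^s(a,b) = div([a,b]^s) -
π(a)(div b) - tr Q, which is `ricci_formula`.

Evaluated on invariant sections, every ingredient descends to the simple reduction. Invariant
sections reach every vector of every fibre (`exists_redSec`), so `ψ` induces isometries between
fibres of the two bundles over the same base point. These intertwine the projections and conjugate
the two endomorphisms Q, while the divergence terms come from the same functions on B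
(`DualityIso.ricci_eq`).

For existence, local flat connections are glued, averaged with the adjoint and compressed to V_+ and
V_-. Subtracting multiples of the components of the torsion makes it vanish (`exists_torsionFree`).
What then separates the divergence from the prescribed one is a section of E^*, absorbed by a
torsion-neutral tensor whose trace on V_s carries the factor 1 - rank V_s. This is where rank 1 is
excluded (`leviCivita_nonempty`). -/

namespace CourantGeometry

/-! ### Local frames, traces and criteria for smoothness. -/

section Frames

theorem fibre_finite {M : Type*} [TopologicalSpace M] (F : Type*) [NormedAddCommGroup F]
    [NormedSpace ℝ F] [FiniteDimensional ℝ F] (E : M → Type*) [TopologicalSpace (TotalSpace F E)]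
    [∀ x, TopologicalSpace (E x)] [FiberBundle F E] [∀ x, AddCommGroup (E x)]
    [∀ x, Module ℝ (E x)] [VectorBundle ℝ F E] (x : M) : Module.Finite ℝ (E x) :=
  Module.Finite.equiv ((trivializationAt F E x).linearEquivAt ℝ x
    (FiberBundle.mem_baseSet_trivializationAt F E x)).symm

variable {m : ℕ} {M : Type*} [TopologicalSpace M] [ChartedSpace (EuclideanSpace ℝ (Fin m)) M]

/-- The derivative along a tangent vector only depends on the germ. -/
theorem dirDeriv_congr {f g : M → ℝ} {x : M} (h : f =ᶠ[nhds x] g)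
    (v : TangentSpace (𝓡 m) x) : dirDeriv f x v = dirDeriv g x v := by
  unfold dirDeriv mvfderiv
  have h1 := h.mfderiv_eq (I := 𝓡 m) (I' := 𝓘(ℝ, ℝ))
  have h2 := h.eq_of_nhds
  rw [h1]
  rfl

theorem dirDeriv_add {f g : M → ℝ} {x : M} (hf : MDifferentiableAt (𝓡 m) 𝓘(ℝ, ℝ) f x)
    (hg : MDifferentiableAt (𝓡 m) 𝓘(ℝ, ℝ) g x) (v : TangentSpace (𝓡 m) x) :
    dirDeriv (fun y => f y + g y) x v = dirDeriv f x v + dirDeriv g x v := by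
  unfold dirDeriv
  change mvfderiv (𝓡 m) (f + g) x v = _
  rw [mvfderiv_add hf hg]
  rfl

theorem dirDeriv_mul {f g : M → ℝ} {x : M} (hf : MDifferentiableAt (𝓡 m) 𝓘(ℝ, ℝ) f x)
    (hg : MDifferentiableAt (𝓡 m) 𝓘(ℝ, ℝ) g x) (v : TangentSpace (𝓡 m) x) :
    dirDeriv (fun y => f y * g y) x v = f x * dirDeriv g x v + dirDeriv f x v * g x := by
  unfold dirDeriv
  change mvfderiv (𝓡 m) (f * g) x v = _
  rw [mvfderiv_mul hf hg]
  change f x * _ + g x * _ = _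
  rw [mul_comm (g x)]
  rfl

theorem dirDeriv_const (c : ℝ) {x : M} (v : TangentSpace (𝓡 m) x) :
    dirDeriv (fun _ : M => c) x v = 0 := by
  unfold dirDeriv
  rw [mvfderiv_const]
  rfl

theorem dirDeriv_sum {ι : Type*} (t : Finset ι) {f : ι → M → ℝ} {x : M}
    (hf : ∀ i ∈ t, MDifferentiableAt (𝓡 m) 𝓘(ℝ, ℝ) (f i) x) (v : TangentSpace (𝓡 m) x) :
    dirDeriv (fun y => ∑ i ∈ t, f i y) x v = ∑ i ∈ t, dirDeriv (f i) x v := by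
  classical
  have : ∀ u ⊆ t, MDifferentiableAt (𝓡 m) 𝓘(ℝ, ℝ) (fun y => ∑ i ∈ u, f i y) x ∧
      dirDeriv (fun y => ∑ i ∈ u, f i y) x v = ∑ i ∈ u, dirDeriv (f i) x v := by
    intro u
    induction u using Finset.induction_on with
    | empty =>
      intro _
      simp only [Finset.sum_empty]
      exact ⟨mdifferentiableAt_const, dirDeriv_const 0 v⟩
    | insert a u ha ih =>
      intro hu
      obtain ⟨h1, h2⟩ := ih fun i hi => hu (Finset.mem_insert_of_mem hi)
      have h3 := hf a (hu (Finset.mem_insert_self a u))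
      simp only [Finset.sum_insert ha]
      exact ⟨h3.add h1, by rw [dirDeriv_add h3 h1, h2]⟩
  exact (this t subset_rfl).2

variable [T2Space M] [IsManifold (𝓡 m) ∞ M]

/-- A bump function with support in a given neighbourhood of `x` that is equal to `1` near `x`. -/
theorem exists_bump_eventually_one {x : M} {U : Set M} (hU : U ∈ nhds x) :
    ∃ ρ : C^∞⟮𝓡 m, M; ℝ⟯, (∀ᶠ y in nhds x, ρ y = 1) ∧ tsupport ρ ⊆ U := by
  obtain ⟨ρ, -, hρ⟩ :=
    (SmoothBumpFunction.nhds_basis_tsupport (I := 𝓡 m) (c := x)).mem_iff.mp hU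
  exact ⟨⟨ρ, ρ.contMDiff⟩, ρ.eventuallyEq_one, hρ⟩

/-- A function that is smooth near `x` has the germ at `x` of a global smooth function. -/
theorem exists_smooth_germ {h : M → ℝ} {x : M} {U : Set M} (hU : IsOpen U) (hx : x ∈ U)
    (hh : ∀ y ∈ U, ContMDiffAt (𝓡 m) 𝓘(ℝ, ℝ) ∞ h y) :
    ∃ f : C^∞⟮𝓡 m, M; ℝ⟯, ∀ᶠ y in nhds x, h y = f y := by
  obtain ⟨ρ, hρ, hs⟩ := exists_bump_eventually_one (m := m) (hU.mem_nhds hx)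
  have hc : ContMDiff (𝓡 m) 𝓘(ℝ, ℝ) ∞ fun y => ρ y * h y := by
    refine contMDiff_of_tsupport fun y hy => ?_
    have hy' : y ∈ U := hs (closure_mono (fun z hz => by
      intro h0; exact hz (by simp [h0])) hy)
    exact ρ.contMDiff.contMDiffAt.mul (hh y hy')
  refine ⟨⟨_, hc⟩, ?_⟩
  filter_upwards [hρ] with y hy
  change h y = ρ y * h y
  rw [hy, one_mul]

/-- The derivative of a smooth function along a smooth vector field is smooth. -/
theorem contMDiff_dirDeriv {f : M → ℝ} (hf : ContMDiff (𝓡 m) 𝓘(ℝ, ℝ) ∞ f)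
    {X : ∀ x : M, TangentSpace (𝓡 m) x}
    (hX : ContMDiff (𝓡 m) (𝓡 m).tangent ∞ fun x => (⟨x, X x⟩ : TangentBundle (𝓡 m) M)) :
    ContMDiff (𝓡 m) 𝓘(ℝ, ℝ) ∞ fun x => dirDeriv f x (X x) := by
  have h := (hf.contMDiff_tangentMap (m := ∞) (by simp)).comp hX
  exact (contMDiff_snd_tangentBundle_modelSpace ℝ 𝓘(ℝ, ℝ)).comp h

/-- A global smooth function with the germ of `f` at `x` also has its germ at all nearby points, so
the two derivatives agree on a neighbourhood. -/
theorem contMDiffAt_dirDeriv {f : M → ℝ} {U : Set M} (hU : IsOpen U) {x : M} (hx : x ∈ U)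
    (hf : ∀ y ∈ U, ContMDiffAt (𝓡 m) 𝓘(ℝ, ℝ) ∞ f y) {X : ∀ x : M, TangentSpace (𝓡 m) x}
    (hX : ContMDiff (𝓡 m) (𝓡 m).tangent ∞ fun x => (⟨x, X x⟩ : TangentBundle (𝓡 m) M)) :
    ContMDiffAt (𝓡 m) 𝓘(ℝ, ℝ) ∞ (fun x => dirDeriv f x (X x)) x := by
  obtain ⟨g, hg⟩ := exists_smooth_germ hU hx hf
  refine ((contMDiff_dirDeriv g.contMDiff hX) x).congr_of_eventuallyEq ?_
  filter_upwards [hg.eventually_nhds] with y hy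
  exact dirDeriv_congr hy _

variable {F : Type*} [NormedAddCommGroup F] [NormedSpace ℝ F]
  {E : M → Type*} [TopologicalSpace (TotalSpace F E)] [∀ x, TopologicalSpace (E x)]
  [FiberBundle F E] [∀ x, AddCommGroup (E x)] [∀ x, Module ℝ (E x)] [VectorBundle ℝ F E]

variable (m F) in
/-- Smoothness of a rough section at a point. -/
abbrev SmoothSecAt (X : ∀ y, E y) (x : M) : Prop :=
  ContMDiffAt (𝓡 m) ((𝓡 m).prod 𝓘(ℝ, F)) ∞ (fun y => TotalSpace.mk' F y (X y)) x

theorem Sec.smoothAt (e : Sec m F E) (x : M) : SmoothSecAt m F (fun y => e y) x :=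
  e.contMDiff.contMDiffAt

theorem Sec.sum_apply {ι : Type*} (t : Finset ι) (s : ι → Sec m F E) (x : M) :
    (∑ i ∈ t, s i) x = ∑ i ∈ t, s i x := by
  rw [← ContMDiffSection.coeAddHom_apply, map_sum, Finset.sum_apply]
  rfl

/-- A first-order differential operator with scalar symbol only depends on the germ. -/
theorem leibniz_local {x : M} (v : TangentSpace (𝓡 m) x) (Φ : Sec m F E → E x)
    (hleib : ∀ (f : C^∞⟮𝓡 m, M; ℝ⟯) d, Φ (fsmul f d) = dirDeriv f x v • d x + f x • Φ d)
    {d d' : Sec m F E} (h : ∀ᶠ y in nhds x, d y = d' y) : Φ d = Φ d' := by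
  -- The cut-off is constant near `x`, so multiplying by it does not change Φ, and its support lies
  -- where the two sections agree, so the cut-off sections are equal everywhere.
  obtain ⟨ρ, hρ, hs⟩ := exists_bump_eventually_one (m := m) h
  have hρx : ρ x = 1 := hρ.self_of_nhds
  have hX : dirDeriv ρ x v = 0 := by
    rw [dirDeriv_congr (g := fun _ => 1) hρ, dirDeriv_const]
  have e1 : fsmul ρ d = fsmul ρ d' := by
    ext y
    by_cases hy : y ∈ tsupport ρ
    · rw [fsmul_apply, fsmul_apply, hs hy]
    · rw [fsmul_apply, fsmul_apply, image_eq_zero_of_notMem_tsupport hy, zero_smul, zero_smul]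
  have h1 := hleib ρ d
  have h2 := hleib ρ d'
  rw [hX, hρx, zero_smul, zero_add, one_smul] at h1 h2
  rw [← h1, ← h2, e1]

variable [FiniteDimensional ℝ F] [ContMDiffVectorBundle ∞ F E (𝓡 m)]

variable (m F E) in
/-- A local frame near `x`: global sections `s j` and coefficient functionals `c j` which are dual
to each other over a neighbourhood of `x`, and detect smoothness there. -/
theorem exists_frame (x : M) : ∃ (U : Set M) (r : ℕ) (s : Fin r → Sec m F E)
    (c : Fin r → ∀ y, E y →ₗ[ℝ] ℝ), IsOpen U ∧ x ∈ U ∧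
    (∀ y ∈ U, ∀ v : E y, v = ∑ j, c j y v • s j y) ∧
    (∀ y ∈ U, ∀ j k, c j y (s k y) = if k = j then 1 else 0) ∧
    ∀ X : ∀ y, E y, ∀ y ∈ U, SmoothSecAt m F X y ↔
      ∀ j, ContMDiffAt (𝓡 m) 𝓘(ℝ, ℝ) ∞ (fun z => c j z (X z)) y := by
  obtain ⟨ρ, hρ, hsupp⟩ := exists_bump_eventually_one (m := m)
    ((trivializationAt F E x).open_baseSet.mem_nhds
      (FiberBundle.mem_baseSet_trivializationAt F E x))
  have : ContMDiffVectorBundle 1 F E (𝓡 m) := ContMDiffVectorBundle.of_le (n := ∞) (by simp)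
  have hbx := FiberBundle.mem_baseSet_trivializationAt F E x
  set t := trivializationAt F E x
  let b := Module.finBasis ℝ F
  let s : Fin (Module.finrank ℝ F) → Sec m F E := fun i =>
    ⟨fun y => ρ y • t.localFrame b i y, ContMDiffOn.smul_section_of_tsupport
      ρ.contMDiff.contMDiffOn t.open_baseSet hsupp (t.contMDiffOn_localFrame_baseSet ∞ b i)⟩
  -- Where the cut-off equals 1, the global sections coincide with the local frame of the
  -- trivialization.
  obtain ⟨U, hU, hUo, hxU⟩ := eventually_nhds_iff.mp hρ
  have hs (y) (hy : y ∈ U) (j) : s j y = t.localFrame b j y := by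
    change ρ y • t.localFrame b j y = _
    rw [hU y hy, one_smul]
  classical
  refine ⟨U ∩ t.baseSet, _, s, fun j y => t.localFrameCoeff (𝓡 m) b j y,
    hUo.inter t.open_baseSet, ⟨hxU, hbx⟩, ?_, ?_, ?_⟩
  · intro y hy v
    -- The expansion is stated for rough sections, so the single vector is extended by zero.
    have h := t.eq_sum_localFrameCoeff_smul (I := 𝓡 m) (b := b)
      (s := Function.update (0 : ∀ y, E y) y v) hy.2
    simp only [Function.update_self] at h
    simp only [hs y hy.1]
    exact h
  · intro y hy j k
    rw [hs y hy.1, t.localFrameCoeff_apply_of_mem_baseSet b hy.2 (t.localFrame b k),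
      t.localFrame_apply_of_mem_baseSet b hy.2, Module.Basis.repr_self, Finsupp.single_apply]
  · intro X y hy
    exact contMDiffAt_iff_localFrameCoeff b hy.2

/-- The trace in terms of a spanning family and coefficient functionals. -/
theorem trace_eq_sum {V : Type*} [AddCommGroup V] [Module ℝ V] [Module.Finite ℝ V] {r : ℕ}
    (s : Fin r → V) (c : Fin r → V →ₗ[ℝ] ℝ) (h : ∀ v, v = ∑ j, c j v • s j) (L : V →ₗ[ℝ] V) :
    LinearMap.trace ℝ V L = ∑ j, c j (L (s j)) := by
  -- Expanding the values of `L` writes it as a sum of maps of rank at most one, whose traces are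
  -- explicit. Linear independence of the family plays no role.
  have hL : L = ∑ j, ((c j).smulRight (s j)) ∘ₗ L := by
    ext v
    simp only [LinearMap.sum_apply, LinearMap.comp_apply, LinearMap.smulRight_apply]
    exact h (L v)
  conv_lhs => rw [hL]
  rw [_root_.map_sum]
  refine Finset.sum_congr rfl fun j _ => ?_
  rw [LinearMap.trace_comp_comm', ← LinearMap.trace_smulRight (R := ℝ) (c j) (L (s j))]
  congr 1
  ext v
  simp

/-- The trace of a smooth field of endomorphisms is smooth. -/
theorem contMDiff_trace (L : ∀ x, E x →ₗ[ℝ] E x)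
    (hL : ∀ e : Sec m F E, ∀ x, SmoothSecAt m F (fun y => L y (e y)) x) :
    ContMDiff (𝓡 m) 𝓘(ℝ, ℝ) ∞ fun x => LinearMap.trace ℝ (E x) (L x) := by
  intro x
  obtain ⟨U, r, s, c, hU, hx, hsc, -, hsm⟩ := exists_frame m F E x
  have h : ContMDiffAt (𝓡 m) 𝓘(ℝ, ℝ) ∞ (fun y => ∑ j, c j y (L y (s j y))) x := by
    refine contMDiffAt_finsetSum fun j _ => ?_
    exact (hsm _ x hx).mp (hL (s j) x) j
  refine h.congr_of_eventuallyEq ?_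
  filter_upwards [hU.mem_nhds hx] with y hy
  have := fibre_finite F E y
  exact trace_eq_sum (fun j => s j y) (fun j => c j y) (hsc y hy) (L y)

/-- If `K` is the commutator of a derivation `Φ` along `v` with a smooth field of endomorphisms
`N`, the trace of `K` is the derivative of the trace of `N`. -/
theorem trace_commutator {x : M} (v : TangentSpace (𝓡 m) x) (Φ : Sec m F E → E x)
    (hadd : ∀ d d', Φ (d + d') = Φ d + Φ d')
    (hleib : ∀ (f : C^∞⟮𝓡 m, M; ℝ⟯) d, Φ (fsmul f d) = dirDeriv f x v • d x + f x • Φ d)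
    (n : ∀ y, E y →ₗ[ℝ] E y) (N : Sec m F E → Sec m F E) (hN : ∀ e y, N e y = n y (e y))
    (K : E x →ₗ[ℝ] E x) (hK : ∀ d, K (d x) = Φ (N d) - n x (Φ d)) :
    LinearMap.trace ℝ (E x) K = dirDeriv (fun y => LinearMap.trace ℝ (E y) (n y)) x v := by
  obtain ⟨U, r, s, c, hU, hx, hsc, hcs, hsm⟩ := exists_frame m F E x
  have hfin (y) := fibre_finite F E y
  have hsmooth (j k) : ∀ y ∈ U, ContMDiffAt (𝓡 m) 𝓘(ℝ, ℝ) ∞ (fun z => c k z (N (s j) z)) y :=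
    fun y hy => (hsm _ y hy).mp ((N (s j)).smoothAt y) k
  -- The entries of the matrix of `N` in the frame are replaced by global functions with the same
  -- germs, to which the Leibniz rule applies.
  choose a ha using fun j k => exists_smooth_germ hU hx (hsmooth j k)
  have hΦsum (t : Finset (Fin r)) (g : Fin r → Sec m F E) :
      Φ (∑ k ∈ t, g k) = ∑ k ∈ t, Φ (g k) :=
    map_sum (AddMonoidHom.mk' Φ hadd) g t
  have hNs (j) : Φ (N (s j)) = ∑ k, (dirDeriv (a j k) x v • s k x + a j k x • Φ (s k)) := by
    rw [leibniz_local v Φ hleib (d' := ∑ k, fsmul (a j k) (s k)), hΦsum]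
    · exact Finset.sum_congr rfl fun k _ => hleib _ _
    · filter_upwards [hU.mem_nhds hx, Filter.eventually_all.mpr (ha j)] with y hy hy2
      rw [hsc y hy (N (s j) y), Sec.sum_apply]
      exact Finset.sum_congr rfl fun k _ => by rw [fsmul_apply, hy2 k]
  have hax (j k) : c k x (n x (s j x)) = a j k x := by
    rw [← hN]
    exact (ha j k).self_of_nhds
  have hn (w : E x) (i) : c i x (n x w) = ∑ k, c k x w * a k i x := by
    conv_lhs => rw [hsc x hx w]
    simp only [_root_.map_sum, _root_.map_smul, smul_eq_mul, hax]
  have htr : dirDeriv (fun y => LinearMap.trace ℝ (E y) (n y)) x v =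
      ∑ j, dirDeriv (a j j) x v := by
    rw [← dirDeriv_sum _ fun j _ => (a j j).contMDiff.mdifferentiable (by simp) x]
    refine dirDeriv_congr ?_ v
    filter_upwards [hU.mem_nhds hx, Filter.eventually_all.mpr fun j => ha j j] with y hy hy2
    rw [trace_eq_sum (fun j => s j y) (fun j => c j y) (hsc y hy) (n y)]
    exact Finset.sum_congr rfl fun j _ => by rw [← hN, hy2]
  rw [htr, trace_eq_sum (fun j => s j x) (fun j => c j x) (hsc x hx) K]
  simp only [hK, hNs, _root_.map_sub, _root_.map_sum, _root_.map_add, _root_.map_smul, smul_eq_mul,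
    hn, hcs x hx, Finset.sum_sub_distrib, Finset.sum_add_distrib]
  have h1 : ∀ j, ∑ k, dirDeriv (a j k) x v * (if k = j then (1 : ℝ) else 0) =
      dirDeriv (a j j) x v := fun j => by simp
  simp only [h1]
  -- The derivatives of the diagonal entries give the claim. What remains is the trace of a
  -- commutator of two matrices, which vanishes after exchanging the summation indices.
  rw [add_sub_assoc, add_eq_left, sub_eq_zero, Finset.sum_comm]
  exact Finset.sum_congr rfl fun k _ => Finset.sum_congr rfl fun j _ => mul_comm _ _

theorem contMDiffAt_det {ι : Type*} [Fintype ι] [DecidableEq ι] {x : M} {A : M → Matrix ι ι ℝ}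
    (hA : ∀ i j, ContMDiffAt (𝓡 m) 𝓘(ℝ, ℝ) ∞ (fun y => A y i j) x) :
    ContMDiffAt (𝓡 m) 𝓘(ℝ, ℝ) ∞ (fun y => (A y).det) x := by
  simp only [Matrix.det_apply]
  refine contMDiffAt_finsetSum fun σ _ => ?_
  have h : ContMDiffAt (𝓡 m) 𝓘(ℝ, ℝ) ∞ (fun y => ∏ i, A y (σ i) i) x :=
    contMDiffAt_finsetProd fun i _ => hA _ _
  rcases Int.units_eq_one_or (Equiv.Perm.sign σ) with h1 | h1 <;> simp only [h1]
  · simpa using h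
  · simpa using h.neg

/-- A rough section is smooth if its pairings with smooth sections are smooth. -/
theorem smoothSecAt_of_pairing (C : CourantAlgebroid m F E) (X : ∀ y, E y)
    (h : ∀ e : Sec m F E, ContMDiff (𝓡 m) 𝓘(ℝ, ℝ) ∞ fun y => C.pairing y (X y) (e y)) (x : M) :
    SmoothSecAt m F X x := by
  obtain ⟨U, r, s, c, hU, hx, hsc, hcs, hsm⟩ := exists_frame m F E x
  rw [hsm X x hx]
  intro j
  -- The coefficients of `X` solve a linear system with the Gram matrix of the frame and smooth
  -- right-hand side, so Cramer's rule makes them quotients of smooth functions.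
  let A : M → Matrix (Fin r) (Fin r) ℝ := fun y => Matrix.of fun i k => C.pairing y (s i y) (s k y)
  have hA (i k) : ContMDiffAt (𝓡 m) 𝓘(ℝ, ℝ) ∞ (fun y => A y i k) x :=
    (C.pairing_smooth (s i) (s k)).contMDiffAt
  let u : M → Fin r → ℝ := fun y k => C.pairing y (X y) (s k y)
  have hvec (y) (hy : y ∈ U) : (A y).mulVec (fun i => c i y (X y)) = u y := by
    funext k
    simp only [u]
    conv_rhs => rw [hsc y hy (X y)]
    simp only [Matrix.mulVec, dotProduct, A, Matrix.of_apply, _root_.map_sum, LinearMap.sum_apply,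
      _root_.map_smul, LinearMap.smul_apply, smul_eq_mul]
    exact Finset.sum_congr rfl fun i _ => by rw [C.pairing_symm, mul_comm]
  -- A kernel vector of the Gram matrix gives a combination of the frame that is orthogonal to
  -- everything. It is zero by nondegeneracy, and the dual functionals read off its coefficients.
  have hdet (y) (hy : y ∈ U) : (A y).det ≠ 0 := by
    intro h0
    obtain ⟨w, hw, hw0⟩ := Matrix.exists_mulVec_eq_zero_iff.mpr h0
    apply hw
    have key (k) : C.pairing y (s k y) (∑ i, w i • s i y) = 0 := by
      refine Eq.trans ?_ (congrFun hw0 k)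
      simp only [Matrix.mulVec, dotProduct, A, Matrix.of_apply, _root_.map_sum, _root_.map_smul,
        smul_eq_mul]
      exact Finset.sum_congr rfl fun i _ => mul_comm _ _
    have hz : ∑ i, w i • s i y = 0 := by
      refine C.pairing_nondeg y _ fun v => ?_
      rw [C.pairing_symm, hsc y hy v, LinearMap.map_sum₂]
      refine Finset.sum_eq_zero fun k _ => ?_
      rw [LinearMap.map_smul₂, key, smul_zero]
    funext i
    have := congrArg (c i y) hz
    simpa [hcs y hy] using this
  have hcram (y) (hy : y ∈ U) : c j y (X y) = (A y).det⁻¹ * ((A y).updateCol j (u y)).det := by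
    have h1 : (A y).cramer (u y) = (A y).det • fun i => c i y (X y) := by
      rw [← hvec y hy, Matrix.cramer_eq_adjugate_mulVec, Matrix.mulVec_mulVec,
        Matrix.adjugate_mul, Matrix.smul_mulVec, Matrix.one_mulVec]
    have h2 := congrFun h1 j
    rw [Matrix.cramer_apply] at h2
    rw [h2, Pi.smul_apply, smul_eq_mul, inv_mul_cancel_left₀ (hdet y hy)]
  have hfin : ContMDiffAt (𝓡 m) 𝓘(ℝ, ℝ) ∞
      (fun y => (A y).det⁻¹ * ((A y).updateCol j (u y)).det) x := by
    refine ContMDiffAt.mul ((contMDiffAt_det hA).inv₀ (hdet x hx)) (contMDiffAt_det fun i k => ?_)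
    simp only [Matrix.updateCol_apply]
    split_ifs
    · exact (h (s i)).contMDiffAt
    · exact hA i k
  refine hfin.congr_of_eventuallyEq ?_
  filter_upwards [hU.mem_nhds hx] with y hy using hcram y hy

end Frames

/-! ### The Ricci tensor in terms of bracket, anchor, splitting and divergence. -/

section Ricci

variable {m : ℕ} {M : Type*} [TopologicalSpace M] [ChartedSpace (EuclideanSpace ℝ (Fin m)) M]
  [IsManifold (𝓡 m) ∞ M]
  {F : Type*} [NormedAddCommGroup F] [NormedSpace ℝ F]
  {E : M → Type*} [TopologicalSpace (TotalSpace F E)] [∀ x, TopologicalSpace (E x)]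
  [FiberBundle F E] [∀ x, AddCommGroup (E x)] [∀ x, Module ℝ (E x)] [VectorBundle ℝ F E]
  {C : CourantAlgebroid m F E}

namespace GeneralizedMetric

variable (V : GeneralizedMetric C)

theorem proj_add_proj (s : ℤˣ) (x : M) (v : E x) : V.proj s x v + V.proj (-s) x v = v := by
  simp only [proj, LinearMap.smul_apply, LinearMap.add_apply, LinearMap.id_apply, Units.val_neg,
    Int.cast_neg]
  module

theorem proj_proj (s : ℤˣ) (x : M) (v : E x) : V.proj s x (V.proj s x v) = V.proj s x v :=
  V.proj_eq (V.proj_mem s x v)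

theorem proj_eq_zero {s : ℤˣ} {x : M} {v : E x} (hv : v ∈ V.sub (-s) x) : V.proj s x v = 0 := by
  have h := V.proj_add_proj s x v
  rwa [V.proj_eq hv, add_eq_right] at h

theorem mem_sub_of_proj_eq {s : ℤˣ} {x : M} {v : E x} (h : V.proj s x v = v) : v ∈ V.sub s x :=
  h ▸ V.proj_mem s x v

theorem pairing_proj_left (s : ℤˣ) (x : M) (v w : E x) :
    C.pairing x (V.proj s x v) w = C.pairing x v (V.proj s x w) := by
  simp only [proj, LinearMap.smul_apply, LinearMap.add_apply, LinearMap.id_apply, map_smul,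
    map_add, V.symm]

theorem pairing_eq_zero {s : ℤˣ} {x : M} {v w : E x} (hv : v ∈ V.sub s x)
    (hw : w ∈ V.sub (-s) x) : C.pairing x v w = 0 := by
  rw [← V.proj_eq hv, ← V.proj_eq hw, V.pairing_proj]

/-- As V_s and V_{-s} are orthogonal, pairings with V_s determine the V_s component. This turns
identities for the torsion into formulas for derivatives. -/
theorem eq_proj {s : ℤˣ} {x : M} {u z : E x} (hu : u ∈ V.sub s x)
    (h : ∀ w ∈ V.sub s x, C.pairing x u w = C.pairing x z w) : u = V.proj s x z := by
  rw [← sub_eq_zero]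
  refine C.pairing_nondeg x _ fun w => ?_
  rw [map_sub, LinearMap.sub_apply, V.pairing_proj_left, ← h _ (V.proj_mem s x w),
    ← V.pairing_proj_left, V.proj_eq hu, sub_self]

theorem projSec_mem (s : ℤˣ) (e : Sec m F E) (x : M) : V.projSec s e x ∈ V.sub s x :=
  V.proj_mem s x (e x)

theorem projSec_add_projSec (s : ℤˣ) (e : Sec m F E) :
    V.projSec s e + V.projSec (-s) e = e := by
  ext x
  exact V.proj_add_proj s x (e x)

variable {V} {D : GeneralizedConnection C}

theorem Compatible.nabla_projSec (hD : V.Compatible D) (s : ℤˣ) (e : Sec m F E) (x : M) (v : E x) :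
    D.nabla (V.projSec s e) x v = V.proj s x (D.nabla e x v) := by
  conv_rhs => rw [← V.projSec_add_projSec s e, D.map_add, LinearMap.add_apply, map_add]
  rw [V.proj_eq (hD s _ (V.projSec_mem s e) x v),
    V.proj_eq_zero (hD (-s) _ (V.projSec_mem (-s) e) x v), add_zero]

/-- The mixed components of a compatible torsion-free connection are given by the bracket. -/
theorem nabla_mixed [T2Space M] [FiniteDimensional ℝ F] [ContMDiffVectorBundle ∞ F E (𝓡 m)]
    (hD : V.Compatible D) (hT : ∀ e₁ e₂ e₃ x, D.torsion e₁ e₂ e₃ x = 0) {s : ℤˣ}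
    {a b : Sec m F E} (ha : ∀ x, a x ∈ V.sub (-s) x) (hb : ∀ x, b x ∈ V.sub s x) (x : M) :
    D.nabla b x (a x) = V.proj s x (C.bracket a b x) := by
  refine V.eq_proj (hD s b hb x _) fun w hw => ?_
  obtain ⟨c', hc'⟩ := exists_sec (m := m) (F := F) (E := E) x w
  set c := V.projSec s c'
  have hc : c x = w := by
    change V.proj s x (c' x) = w
    rw [hc', V.proj_eq hw]
  have h := hT a b c x
  -- Derivatives of `a` stay in V_{-s}, orthogonal to `b` and `c`. Of the torsion only ⟨D_a b -
  -- [a,b], c⟩ survives.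
  have h1 : C.pairing x (D.cov c a x) (b x) = 0 := by
    rw [C.pairing_symm]
    exact V.pairing_eq_zero (hb x) (hD (-s) a ha x _)
  have h2 : C.pairing x (D.cov b a x) (c x) = 0 := by
    rw [C.pairing_symm]
    exact V.pairing_eq_zero (V.projSec_mem s c' x) (hD (-s) a ha x _)
  rw [GeneralizedConnection.torsion, h1, add_zero, Sec.sub_apply, Sec.sub_apply, map_sub, map_sub,
    LinearMap.sub_apply, LinearMap.sub_apply, h2, sub_zero, sub_eq_zero, hc] at h
  exact h

variable [T2Space M] [FiniteDimensional ℝ F] [ContMDiffVectorBundle ∞ F E (𝓡 m)]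

/-- The fibre map already projects its argument to V_s, so cyclicity of the trace moves the
computation from V_s to E, where frames are at hand. -/
theorem ricci_eq_trace (s : ℤˣ) (e₁ e₂ : Sec m F E) (x : M) :
    V.ricci s D e₁ e₂ x = LinearMap.trace ℝ (E x) (fibreMap x
      (fun d => D.curv (V.projSec s d) (V.projSec (-s) e₁) (V.projSec s e₂) x)
      (V.curv_add D s e₁ e₂ x) (V.curv_fsmul D s e₁ e₂ x)) := by
  have hfin := fibre_finite F E x
  unfold ricci curvEnd
  set L := fibreMap x
      (fun d => D.curv (V.projSec s d) (V.projSec (-s) e₁) (V.projSec s e₂) x)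
      (V.curv_add D s e₁ e₂ x) (V.curv_fsmul D s e₁ e₂ x) with hL
  rw [LinearMap.trace_comp_comm']
  congr 1
  ext v
  obtain ⟨d, rfl⟩ := exists_sec (m := m) (F := F) (E := E) x v
  change L (V.projSec s d x) = L (d x)
  rw [hL, fibreMap_apply, fibreMap_apply, V.projSec_eq (V.projSec_mem s d)]

/-- The Ricci tensor of a Levi-Civita connection, in terms of the bracket, the anchor and the
divergence operator. -/
theorem ricci_formula (V : GeneralizedMetric C) {dv : DivergenceOperator C}
    (hD : D ∈ V.leviCivita dv) (s : ℤˣ) (e₁ e₂ : Sec m F E) (x : M) :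
    ∃ Q : E x →ₗ[ℝ] E x,
      (∀ d : Sec m F E, Q (d x) = V.projSec s (C.bracket (V.projSec (-s)
        (C.bracket (V.projSec s d) (V.projSec (-s) e₁))) (V.projSec s e₂)) x) ∧
      V.ricci s D e₁ e₂ x =
        dv.toFun (V.projSec s (C.bracket (V.projSec (-s) e₁) (V.projSec s e₂))) x -
        dirDeriv (dv.toFun (V.projSec s e₂)) x (C.anchor x (V.projSec (-s) e₁ x)) -
        LinearMap.trace ℝ (E x) Q := by
  obtain ⟨hc, hT, hdiv⟩ := hD
  have hfin (y) := fibre_finite F E y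
  rw [ricci_eq_trace s e₁ e₂ x]
  set a := V.projSec (-s) e₁ with ha
  set b := V.projSec s e₂ with hb
  have ham : ∀ y, a y ∈ V.sub (-s) y := V.projSec_mem (-s) e₁
  have hbm : ∀ y, b y ∈ V.sub s y := V.projSec_mem s e₂
  set L := fibreMap x (fun d => D.curv (V.projSec s d) a b x)
      (V.curv_add D s e₁ e₂ x) (V.curv_fsmul D s e₁ e₂ x) with hL
  -- `D.nabla c` takes values in V_s, so restricting its argument to V_s does not change its trace.
  have htr (c : Sec m F E) (hcm : ∀ y, c y ∈ V.sub s y) (y) :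
      LinearMap.trace ℝ (E y) (D.nabla c y ∘ₗ V.proj s y) = dv.toFun c y := by
    rw [LinearMap.trace_comp_comm', ← hdiv c y]
    unfold GeneralizedConnection.divergence
    congr 1
    ext v
    exact V.proj_eq (hc s c hcm y v)
  let Φ : Sec m F E → E x := fun d => D.nabla d x (a x)
  let n : ∀ y, E y →ₗ[ℝ] E y := fun y => D.nabla b y ∘ₗ V.proj s y
  let N : Sec m F E → Sec m F E := fun d => D.cov (V.projSec s d) b
  have hadd (d d') : Φ (d + d') = Φ d + Φ d' := by
    simp only [Φ, D.map_add, LinearMap.add_apply]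
  have hleib (f : C^∞⟮𝓡 m, M; ℝ⟯) (d) :
      Φ (fsmul f d) = dirDeriv f x (C.anchor x (a x)) • d x + f x • Φ d := D.leibniz f d x _
  have hN (d y) : N d y = n y (d y) := rfl
  have hNadd (d d') : N (d + d') = N d + N d' := by
    ext y
    exact (n y).map_add _ _
  have hNsmul (f : C^∞⟮𝓡 m, M; ℝ⟯) (d) : N (fsmul f d) = fsmul f (N d) := by
    ext y
    exact (n y).map_smul _ _
  -- The commutator of D_a with Db: the derivatives of the coefficient function cancel, so it is
  -- tensorial.
  obtain ⟨K, hK⟩ := exists_fibreMap x (fun d => Φ (N d) - n x (Φ d))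
    (fun d d' => by simp only [hNadd, hadd, map_add]; abel)
    (fun f d => by
      simp only [hNsmul, hleib, map_add, map_smul, hN]
      module)
  have hKtr := trace_commutator _ Φ hadd hleib n N hN K hK
  have hc' : D.cov a b = V.projSec s (C.bracket a b) := by
    ext y
    exact nabla_mixed hc hT ham hbm y
  -- Q is taken to be what the trace identity requires; the work is to recognise it as the iterated
  -- bracket.
  refine ⟨D.nabla (D.cov a b) x ∘ₗ V.proj s x - K - L, fun d => ?_, ?_⟩
  · have hds := V.projSec_mem s d
    set ds := V.projSec s d with hdsdef
    have hLd : L (d x) = D.curv ds a b x := fibreMap_apply x _ _ _ d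
    -- The V_s part of D_a d is D_a d^s = [a,d^s]^s, and the bracket of orthogonal sections is skew.
    have hmix : n x (Φ d) = -D.nabla b x (V.proj s x (C.bracket ds a x)) := by
      change D.nabla b x (V.proj s x (D.nabla d x (a x))) = _
      rw [← hc.nabla_projSec, ← hdsdef, nabla_mixed hc hT ham hds x,
        CourantAlgebroid.bracket_swap a ds (fun y => by
          rw [C.pairing_symm]; exact V.pairing_eq_zero (hds y) (ham y)), map_neg, map_neg]
    -- The V_s part of [d,a] cancels against `hmix`; along the V_{-s} part the derivative of `b` is
    -- mixed, hence a bracket.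
    have hsplit : D.nabla b x (C.bracket ds a x) = D.nabla b x (V.proj s x (C.bracket ds a x)) +
        V.proj s x (C.bracket (V.projSec (-s) (C.bracket ds a)) b x) := by
      rw [← nabla_mixed hc hT (V.projSec_mem (-s) _) hbm x, ← map_add]
      congr 1
      exact (V.proj_add_proj s x _).symm
    rw [LinearMap.sub_apply, LinearMap.sub_apply, hLd, hK, hmix]
    change D.nabla (D.cov a b) x (ds x) - (D.nabla (D.cov ds b) x (a x) - _) -
      (D.nabla (D.cov a b) x (ds x) - D.nabla (D.cov ds b) x (a x) -
        D.nabla b x (C.bracket ds a x)) =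
      V.proj s x (C.bracket (V.projSec (-s) (C.bracket ds a)) b x)
    rw [hsplit]
    abel
  · rw [map_sub, map_sub, hKtr, htr _ (fun y => hc s b hbm y _)]
    simp only [n, htr b hbm, hc']
    abel

end GeneralizedMetric

end Ricci

/-! ### Isometries between fibres that respect V_+. -/

section Intertwine

variable {m₁ m₂ : ℕ}
  {M₁ : Type*} [TopologicalSpace M₁] [ChartedSpace (EuclideanSpace ℝ (Fin m₁)) M₁]
  [IsManifold (𝓡 m₁) ∞ M₁]
  {F₁ : Type*} [NormedAddCommGroup F₁] [NormedSpace ℝ F₁]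
  {E₁ : M₁ → Type*} [TopologicalSpace (TotalSpace F₁ E₁)] [∀ x, TopologicalSpace (E₁ x)]
  [FiberBundle F₁ E₁] [∀ x, AddCommGroup (E₁ x)] [∀ x, Module ℝ (E₁ x)] [VectorBundle ℝ F₁ E₁]
  {M₂ : Type*} [TopologicalSpace M₂] [ChartedSpace (EuclideanSpace ℝ (Fin m₂)) M₂]
  [IsManifold (𝓡 m₂) ∞ M₂]
  {F₂ : Type*} [NormedAddCommGroup F₂] [NormedSpace ℝ F₂]
  {E₂ : M₂ → Type*} [TopologicalSpace (TotalSpace F₂ E₂)] [∀ x, TopologicalSpace (E₂ x)]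
  [FiberBundle F₂ E₂] [∀ x, AddCommGroup (E₂ x)] [∀ x, Module ℝ (E₂ x)] [VectorBundle ℝ F₂ E₂]
  {C₁ : CourantAlgebroid m₁ F₁ E₁} {C₂ : CourantAlgebroid m₂ F₂ E₂}

/-- A surjective isometry between fibres that identifies the subspaces `V_+` intertwines the
projections. -/
theorem map_proj_of_isometry (V₁ : GeneralizedMetric C₁) (V₂ : GeneralizedMetric C₂) {x₁ : M₁}
    {x₂ : M₂} (Φ : E₁ x₁ →ₗ[ℝ] E₂ x₂) (hsurj : Function.Surjective Φ)
    (hpair : ∀ v w, C₂.pairing x₂ (Φ v) (Φ w) = C₁.pairing x₁ v w)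
    (hplus : ∀ v, v ∈ V₁.sub 1 x₁ ↔ Φ v ∈ V₂.sub 1 x₂) (s : ℤˣ) (v : E₁ x₁) :
    Φ (V₁.proj s x₁ v) = V₂.proj s x₂ (Φ v) := by
  -- V_- is the orthogonal complement of V_+, and by surjectivity each vector of the target V_+
  -- comes from the source V_+.
  have hminus (v) (hv : v ∈ V₁.sub (-1) x₁) : Φ v ∈ V₂.sub (-1) x₂ := by
    have h0 : V₂.proj 1 x₂ (Φ v) = 0 := by
      refine C₂.pairing_nondeg x₂ _ fun w => ?_
      obtain ⟨u, hu⟩ := hsurj (V₂.proj 1 x₂ w)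
      have hu1 : u ∈ V₁.sub 1 x₁ := (hplus u).mpr (hu ▸ V₂.proj_mem 1 x₂ w)
      rw [V₂.pairing_proj_left, ← hu, hpair, C₁.pairing_symm]
      exact V₁.pairing_eq_zero hu1 hv
    have h1 := V₂.proj_add_proj 1 x₂ (Φ v)
    rw [h0, zero_add] at h1
    exact V₂.mem_sub_of_proj_eq h1
  have hsub (s : ℤˣ) (v) (hv : v ∈ V₁.sub s x₁) : Φ v ∈ V₂.sub s x₂ := by
    rcases Int.units_eq_one_or s with rfl | rfl
    · exact (hplus v).mp hv
    · exact hminus v hv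
  conv_rhs => rw [← V₁.proj_add_proj s x₁ v, map_add, map_add]
  rw [V₂.proj_eq (hsub s _ (V₁.proj_mem s x₁ v)),
    V₂.proj_eq_zero (hsub (-s) _ (V₁.proj_mem (-s) x₁ v)), add_zero]

end Intertwine

/-! ### Invariant sections and the fibres of the simple reduction. -/

section Invariant

variable {k m n : ℕ}
  {T : Type*} [TopologicalSpace T] [ChartedSpace (EuclideanSpace ℝ (Fin k)) T] [CommGroup T]
  {M : Type*} [TopologicalSpace M] [ChartedSpace (EuclideanSpace ℝ (Fin m)) M]
  [MulAction T M]
  {B : Type*} [TopologicalSpace B] [ChartedSpace (EuclideanSpace ℝ (Fin n)) B]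
  [IsManifold (𝓡 m) ∞ M]
  {F : Type*} [NormedAddCommGroup F] [NormedSpace ℝ F]
  {E : M → Type*} [TopologicalSpace (TotalSpace F E)] [∀ x, TopologicalSpace (E x)]
  [FiberBundle F E] [∀ x, AddCommGroup (E x)] [∀ x, Module ℝ (E x)] [VectorBundle ℝ F E]

/-- Points such as t⁻¹ • t • x and x are equal only propositionally. Comparing vectors in the total
space avoids casts between their fibres. -/
theorem exists_mk_eq {p : TotalSpace F E} {y : M} (h : p.proj = y) :
    ∃ u : E y, TotalSpace.mk' F y u = p := by
  subst h
  exact ⟨p.snd, rfl⟩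

theorem mk_injective {y : M} {u v : E y} (h : TotalSpace.mk' F y u = TotalSpace.mk' F y v) :
    u = v := by
  simpa using h

namespace EquivariantCourantAlgebroid

variable (𝓔 : EquivariantCourantAlgebroid k m n T B F E)

/-- The action on the total space of the bundle. -/
def totalAct (t : T) (p : TotalSpace F E) : TotalSpace F E :=
  TotalSpace.mk' F (t • p.proj) (𝓔.act t p.proj p.snd)

theorem totalAct_one (p : TotalSpace F E) : 𝓔.totalAct 1 p = p := 𝓔.act_one p.proj p.snd

theorem totalAct_mul (s t : T) (p : TotalSpace F E) :
    𝓔.totalAct (s * t) p = 𝓔.totalAct s (𝓔.totalAct t p) := 𝓔.act_mul s t p.proj p.snd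

theorem act_surjective (t : T) (x : M) : Function.Surjective (𝓔.act t x) := by
  intro v
  obtain ⟨u, hu⟩ := exists_mk_eq (p := 𝓔.totalAct t⁻¹ (TotalSpace.mk' F (t • x) v)) (y := x)
    (inv_smul_smul t x)
  refine ⟨u, mk_injective (F := F) ?_⟩
  change 𝓔.totalAct t (TotalSpace.mk' F x u) = _
  rw [hu, ← totalAct_mul, mul_inv_cancel, totalAct_one]

/-- Invariance is given as an inclusion; acting with t⁻¹ yields the converse. -/
theorem act_mem_sub_one_iff {V : GeneralizedMetric 𝓔.courant} (hV : 𝓔.InvariantMetric V) (t : T)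
    (x : M) (v : E x) : v ∈ V.sub 1 x ↔ 𝓔.act t x v ∈ V.sub 1 (t • x) := by
  refine ⟨hV t x v, fun h => ?_⟩
  have hP (t : T) (p : TotalSpace F E) (hp : p.snd ∈ V.sub 1 p.proj) :
      (𝓔.totalAct t p).snd ∈ V.sub 1 (𝓔.totalAct t p).proj := hV t _ _ hp
  have h2 := hP t⁻¹ (𝓔.totalAct t (TotalSpace.mk' F x v)) h
  rw [← totalAct_mul, inv_mul_cancel, totalAct_one] at h2
  exact h2

theorem proj_act {V : GeneralizedMetric 𝓔.courant} (hV : 𝓔.InvariantMetric V) (s : ℤˣ) (t : T)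
    (x : M) (v : E x) : V.proj s (t • x) (𝓔.act t x v) = 𝓔.act t x (V.proj s x v) :=
  (map_proj_of_isometry V V (𝓔.act t x) (𝓔.act_surjective t x) (𝓔.pairing_act t x)
    (𝓔.act_mem_sub_one_iff hV t x) s v).symm

/-- The projection to `V_s` of an invariant section. -/
def redProj {V : GeneralizedMetric 𝓔.courant} (hV : 𝓔.InvariantMetric V) (s : ℤˣ)
    (e : 𝓔.redSec) : 𝓔.redSec :=
  ⟨V.projSec s e.1, fun t x => by
    change V.proj s (t • x) (e.1 (t • x)) = 𝓔.act t x (V.proj s x (e.1 x))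
    rw [e.2 t x, 𝓔.proj_act hV]⟩

variable [T2Space B] [IsManifold (𝓡 n) ∞ B] [T2Space M] [FiniteDimensional ℝ F]
  [ContMDiffVectorBundle ∞ F E (𝓡 m)]

/-- Every vector is the value of an invariant section. -/
theorem exists_redSec (x₀ : M) (v : E x₀) : ∃ e : 𝓔.redSec, e.1 x₀ = v := by
  set p := 𝓔.bundle.proj
  obtain ⟨U, σ, τ, hU, hb, hσ, hpσ, hτ, hτσ⟩ := 𝓔.bundle.locally_trivial (p x₀)
  obtain ⟨ρ, hρ, hsupp⟩ := exists_bump (m := n) (hU.mem_nhds hb)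
  -- The vector is carried to the local section σ, extended there to a smooth section `w` of E, and
  -- spread along the orbits by the fibre coordinate τ.
  obtain ⟨u, hu⟩ := exists_mk_eq (p := 𝓔.totalAct (τ x₀)⁻¹ (TotalSpace.mk' F x₀ v))
    (y := σ (p x₀)) (by
      change (τ x₀)⁻¹ • x₀ = _
      rw [inv_smul_eq_iff, hτσ x₀ hb])
  obtain ⟨w, hw⟩ := exists_sec (m := m) (F := F) (E := E) (σ (p x₀)) u
  let Z : M → TotalSpace F E := fun y =>
    𝓔.totalAct (τ y) (TotalSpace.mk' F (σ (p y)) (w (σ (p y))))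
  -- The value off the preimage of `U` is irrelevant, since the cut-off vanishes there.
  have hex (y : M) : ∃ z : E y, p y ∈ U → TotalSpace.mk' F y z = Z y := by
    by_cases hy : p y ∈ U
    · obtain ⟨z, hz⟩ := exists_mk_eq (p := Z y) (y := y) (hτσ y hy)
      exact ⟨z, fun _ => hz⟩
    · exact ⟨0, fun h => absurd h hy⟩
  choose z hz using hex
  -- Equivariance of τ follows from freeness of the action. It makes the spread-out section
  -- invariant.
  have hτs (t : T) (y : M) (hy : p y ∈ U) : τ (t • y) = t * τ y := by
    have h1 := hτσ (t • y) ((𝓔.bundle.proj_smul t y).symm ▸ hy)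
    rw [𝓔.bundle.proj_smul] at h1
    have h2 : (t * τ y) • σ (p y) = t • y := by rw [mul_smul, hτσ y hy]
    have h3 := 𝓔.bundle.free ((τ (t • y))⁻¹ * (t * τ y)) (σ (p y)) (by
      rw [mul_smul, h2, inv_smul_eq_iff, h1])
    exact (inv_mul_eq_one.mp h3)
  have hUo : IsOpen (p ⁻¹' U) := hU.preimage 𝓔.bundle.smooth.continuous
  have hZ : ContMDiffOn (𝓡 m) ((𝓡 m).prod 𝓘(ℝ, F)) ∞ Z (p ⁻¹' U) := by
    have h1 : ContMDiffOn (𝓡 m) ((𝓡 m).prod 𝓘(ℝ, F)) ∞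
        (fun y => TotalSpace.mk' F (σ (p y)) (w (σ (p y)))) (p ⁻¹' U) :=
      w.contMDiff.comp_contMDiffOn (hσ.comp 𝓔.bundle.smooth.contMDiffOn fun y hy => hy)
    exact 𝓔.act_smooth.comp_contMDiffOn (hτ.prodMk h1)
  have hzs : ContMDiffOn (𝓡 m) ((𝓡 m).prod 𝓘(ℝ, F)) ∞ (fun y => TotalSpace.mk' F y (z y))
      (p ⁻¹' U) := hZ.congr fun y hy => hz y hy
  -- The cut-off is pulled back from the base, so it preserves invariance.
  have hρp : ContMDiff (𝓡 m) 𝓘(ℝ, ℝ) ∞ (fun y => ρ (p y)) :=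
    ρ.contMDiff.comp 𝓔.bundle.smooth
  have hsupp' : tsupport (fun y => ρ (p y)) ⊆ p ⁻¹' U := by
    refine Set.Subset.trans ?_ (Set.preimage_mono hsupp)
    exact closure_minimal (fun y hy => subset_closure hy)
      ((isClosed_tsupport ρ).preimage 𝓔.bundle.smooth.continuous)
  let e : Sec m F E := ⟨fun y => ρ (p y) • z y,
    ContMDiffOn.smul_section_of_tsupport hρp.contMDiffOn hUo hsupp' hzs⟩
  refine ⟨⟨e, fun t y => ?_⟩, ?_⟩
  · change ρ (p (t • y)) • z (t • y) = 𝓔.act t y (ρ (p y) • z y)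
    have hp : p (t • y) = p y := 𝓔.bundle.proj_smul t y
    rw [hp, map_smul]
    by_cases hy : p y ∈ U
    · congr 1
      refine mk_injective (F := F) ?_
      rw [hz _ (hp.symm ▸ hy)]
      change 𝓔.totalAct _ _ = 𝓔.totalAct t (TotalSpace.mk' F y (z y))
      rw [hz y hy, hτs t y hy, totalAct_mul, hp]
    · rw [image_eq_zero_of_notMem_tsupport fun h => hy (hsupp h), zero_smul, zero_smul]
  · change ρ (p x₀) • z x₀ = v
    rw [hρ, one_smul]
    refine mk_injective (F := F) ?_
    rw [hz x₀ hb]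
    change 𝓔.totalAct _ (TotalSpace.mk' F _ _) = _
    rw [hw, hu, ← totalAct_mul, mul_inv_cancel, totalAct_one]

/-- A representative at one point of an orbit determines the others through the action, and each
vector extends to an invariant section. -/
theorem rep_bijective (b : B) (x : {x // 𝓔.bundle.proj x = b}) :
    Function.Bijective (𝓔.rep b x) := by
  refine ⟨(injective_iff_map_eq_zero _).mpr fun v hv => ?_, fun w => ?_⟩
  · refine Subtype.ext (funext fun y => ?_)
    obtain ⟨t, ht⟩ := (𝓔.bundle.fibre x.1 y.1).mp (x.2.trans y.2.symm)
    obtain rfl : y = ⟨t • x.1, (𝓔.bundle.proj_smul t x.1).trans x.2⟩ := Subtype.ext ht.symm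
    have h := 𝓔.rep_smul b v t x
    rw [hv, map_zero] at h
    exact h
  · obtain ⟨e, he⟩ := 𝓔.exists_redSec x.1 w
    exact ⟨𝓔.value b e, he⟩

/-- The identification of a fibre of the simple reduction with a fibre of the bundle. -/
def repEquiv (b : B) (x : {x // 𝓔.bundle.proj x = b}) : 𝓔.redFibre b ≃ₗ[ℝ] E x.1 :=
  LinearEquiv.ofBijective (𝓔.rep b x) (𝓔.rep_bijective b x)

theorem mem_pushMetric_iff {V : GeneralizedMetric 𝓔.courant} (hV : 𝓔.InvariantMetric V) (b : B)
    (x : {x // 𝓔.bundle.proj x = b}) (v : 𝓔.redFibre b) :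
    v ∈ 𝓔.pushMetric V b ↔ 𝓔.rep b x v ∈ V.sub 1 x.1 := by
  unfold pushMetric
  rw [Submodule.mem_iInf]
  refine ⟨fun h => h x, fun h y => ?_⟩
  obtain ⟨t, ht⟩ := (𝓔.bundle.fibre x.1 y.1).mp (x.2.trans y.2.symm)
  obtain rfl : y = ⟨t • x.1, (𝓔.bundle.proj_smul t x.1).trans x.2⟩ := Subtype.ext ht.symm
  rw [Submodule.mem_comap, 𝓔.rep_smul]
  exact hV t _ _ h

/-- A function on the base with smooth pull-back is smooth. -/
theorem contMDiff_of_comp_proj {g : B → ℝ}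
    (hg : ContMDiff (𝓡 m) 𝓘(ℝ, ℝ) ∞ fun x => g (𝓔.bundle.proj x)) :
    ContMDiff (𝓡 n) 𝓘(ℝ, ℝ) ∞ g := by
  intro b
  obtain ⟨U, σ, τ, hU, hb, hσ, hpσ, -, -⟩ := 𝓔.bundle.locally_trivial b
  refine ((hg.comp_contMDiffOn hσ).contMDiffAt (hU.mem_nhds hb)).congr_of_eventuallyEq ?_
  filter_upwards [hU.mem_nhds hb] with u hu
  simp only [Function.comp, hpσ u hu]

theorem dirDeriv_comp_proj {g : B → ℝ} (hg : ContMDiff (𝓡 n) 𝓘(ℝ, ℝ) ∞ g) (x : M) (v : E x) :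
    dirDeriv (fun y => g (𝓔.bundle.proj y)) x (𝓔.courant.anchor x v) =
      dirDeriv g (𝓔.bundle.proj x) (𝓔.baseAnchor x v) :=
  mvfderiv_comp_apply x (hg.mdifferentiable (by simp) _)
    (𝓔.bundle.smooth.mdifferentiable (by simp) x) _

end EquivariantCourantAlgebroid

end Invariant

/-! ### Comparison of the Ricci tensors across the duality. -/

section DualityRicci

variable {k₁ k₂ m₁ m₂ n : ℕ} {B : Type*} [TopologicalSpace B]
  [ChartedSpace (EuclideanSpace ℝ (Fin n)) B] [T2Space B] [IsManifold (𝓡 n) ∞ B]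
  {T₁ : Type*} [TopologicalSpace T₁] [ChartedSpace (EuclideanSpace ℝ (Fin k₁)) T₁] [CommGroup T₁]
  {M₁ : Type*} [TopologicalSpace M₁] [ChartedSpace (EuclideanSpace ℝ (Fin m₁)) M₁]
  [IsManifold (𝓡 m₁) ∞ M₁] [T2Space M₁] [MulAction T₁ M₁] [ContMDiffSMul (𝓡 k₁) (𝓡 m₁) ∞ T₁ M₁]
  {F₁ : Type*} [NormedAddCommGroup F₁] [NormedSpace ℝ F₁] [FiniteDimensional ℝ F₁]
  {E₁ : M₁ → Type*} [TopologicalSpace (TotalSpace F₁ E₁)] [∀ x, TopologicalSpace (E₁ x)]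
  [FiberBundle F₁ E₁] [∀ x, AddCommGroup (E₁ x)] [∀ x, Module ℝ (E₁ x)] [VectorBundle ℝ F₁ E₁]
  [ContMDiffVectorBundle ∞ F₁ E₁ (𝓡 m₁)]
  {T₂ : Type*} [TopologicalSpace T₂] [ChartedSpace (EuclideanSpace ℝ (Fin k₂)) T₂] [CommGroup T₂]
  {M₂ : Type*} [TopologicalSpace M₂] [ChartedSpace (EuclideanSpace ℝ (Fin m₂)) M₂]
  [IsManifold (𝓡 m₂) ∞ M₂] [T2Space M₂] [MulAction T₂ M₂] [ContMDiffSMul (𝓡 k₂) (𝓡 m₂) ∞ T₂ M₂]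
  {F₂ : Type*} [NormedAddCommGroup F₂] [NormedSpace ℝ F₂] [FiniteDimensional ℝ F₂]
  {E₂ : M₂ → Type*} [TopologicalSpace (TotalSpace F₂ E₂)] [∀ x, TopologicalSpace (E₂ x)]
  [FiberBundle F₂ E₂] [∀ x, AddCommGroup (E₂ x)] [∀ x, Module ℝ (E₂ x)] [VectorBundle ℝ F₂ E₂]
  [ContMDiffVectorBundle ∞ F₂ E₂ (𝓡 m₂)]
  {𝓔₁ : EquivariantCourantAlgebroid k₁ m₁ n T₁ B F₁ E₁}
  {𝓔₂ : EquivariantCourantAlgebroid k₂ m₂ n T₂ B F₂ E₂}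

namespace DualityIso

variable (ψ : DualityIso 𝓔₁ 𝓔₂)

/-- The identification of fibres over the same point of the base that is induced by a duality
isomorphism. -/
def fibreEquiv {b : B} (x₁ : {x // 𝓔₁.bundle.proj x = b}) (x₂ : {x // 𝓔₂.bundle.proj x = b}) :
    E₁ x₁.1 ≃ₗ[ℝ] E₂ x₂.1 :=
  (𝓔₁.repEquiv b x₁).symm.trans ((ψ.fibre b).trans (𝓔₂.repEquiv b x₂))

variable {b : B} (x₁ : {x // 𝓔₁.bundle.proj x = b}) (x₂ : {x // 𝓔₂.bundle.proj x = b})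

theorem fibreEquiv_rep (v : 𝓔₁.redFibre b) :
    ψ.fibreEquiv x₁ x₂ (𝓔₁.rep b x₁ v) = 𝓔₂.rep b x₂ (ψ.fibre b v) := by
  change 𝓔₂.repEquiv b x₂ (ψ.fibre b ((𝓔₁.repEquiv b x₁).symm (𝓔₁.repEquiv b x₁ v))) = _
  rw [LinearEquiv.symm_apply_apply]
  rfl

theorem fibreEquiv_apply (e : 𝓔₁.redSec) :
    ψ.fibreEquiv x₁ x₂ (e.1 x₁.1) = (ψ.sec e).1 x₂.1 := by
  rw [← 𝓔₁.rep_value b x₁ e, fibreEquiv_rep, ← ψ.value_sec, 𝓔₂.rep_value]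

theorem pairing_fibreEquiv (v w : E₁ x₁.1) :
    𝓔₂.courant.pairing x₂.1 (ψ.fibreEquiv x₁ x₂ v) (ψ.fibreEquiv x₁ x₂ w) =
      𝓔₁.courant.pairing x₁.1 v w := by
  obtain ⟨v, rfl⟩ := (𝓔₁.rep_bijective b x₁).2 v
  obtain ⟨w, rfl⟩ := (𝓔₁.rep_bijective b x₁).2 w
  rw [fibreEquiv_rep, fibreEquiv_rep, ← 𝓔₂.redPairing_apply, ψ.pairing, 𝓔₁.redPairing_apply]

theorem baseAnchor_fibreEquiv (v : E₁ x₁.1) :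
    𝓔₂.baseAnchor x₂.1 (ψ.fibreEquiv x₁ x₂ v) = 𝓔₁.baseAnchor x₁.1 v := by
  obtain ⟨v, rfl⟩ := (𝓔₁.rep_bijective b x₁).2 v
  rw [fibreEquiv_rep, ← 𝓔₂.redAnchor_apply, ψ.anchor, 𝓔₁.redAnchor_apply]

variable {V₁ : GeneralizedMetric 𝓔₁.courant} {V₂ : GeneralizedMetric 𝓔₂.courant}
  (hV₁ : 𝓔₁.InvariantMetric V₁) (hV₂ : 𝓔₂.InvariantMetric V₂)
  (hmetric : ∀ b, (𝓔₁.pushMetric V₁ b).map (ψ.fibre b).toLinearMap = 𝓔₂.pushMetric V₂ b)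

include hV₁ hV₂ hmetric in
theorem fibreEquiv_proj (s : ℤˣ) (v : E₁ x₁.1) :
    ψ.fibreEquiv x₁ x₂ (V₁.proj s x₁.1 v) = V₂.proj s x₂.1 (ψ.fibreEquiv x₁ x₂ v) := by
  refine map_proj_of_isometry V₁ V₂ (ψ.fibreEquiv x₁ x₂).toLinearMap
    (ψ.fibreEquiv x₁ x₂).surjective (ψ.pairing_fibreEquiv x₁ x₂) (fun v => ?_) s v
  obtain ⟨v, rfl⟩ := (𝓔₁.rep_bijective b x₁).2 v
  change _ ↔ ψ.fibreEquiv x₁ x₂ _ ∈ _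
  rw [fibreEquiv_rep, ← 𝓔₁.mem_pushMetric_iff hV₁, ← 𝓔₂.mem_pushMetric_iff hV₂, ← hmetric]
  refine ⟨fun h => Submodule.mem_map_of_mem h, fun h => ?_⟩
  obtain ⟨u, hu, huv⟩ := h
  exact (ψ.fibre b).injective huv ▸ hu

include hmetric in
theorem sec_redProj (s : ℤˣ) (e : 𝓔₁.redSec) :
    ψ.sec (𝓔₁.redProj hV₁ s e) = 𝓔₂.redProj hV₂ s (ψ.sec e) := by
  refine Subtype.ext (ContMDiffSection.ext fun y => ?_)
  obtain ⟨x, hx⟩ := 𝓔₁.bundle.surjective (𝓔₂.bundle.proj y)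
  rw [← ψ.fibreEquiv_apply ⟨x, hx⟩ ⟨y, rfl⟩]
  change ψ.fibreEquiv ⟨x, hx⟩ ⟨y, rfl⟩ (V₁.proj s x (e.1 x)) = V₂.proj s y ((ψ.sec e).1 y)
  rw [ψ.fibreEquiv_proj ⟨x, hx⟩ ⟨y, rfl⟩ hV₁ hV₂ hmetric,
    ψ.fibreEquiv_apply ⟨x, hx⟩ ⟨y, rfl⟩]

/-- The Ricci tensors of dual pairs agree at points over the same point of the base. -/
theorem ricci_eq {div₁ : DivergenceOperator 𝓔₁.courant} {div₂ : DivergenceOperator 𝓔₂.courant}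
    (hV₁ : 𝓔₁.InvariantMetric V₁) (hV₂ : 𝓔₂.InvariantMetric V₂)
    (hdual : DualPairs ψ V₁ div₁ V₂ div₂)
    {D₁ : GeneralizedConnection 𝓔₁.courant} (hD₁ : D₁ ∈ V₁.leviCivita div₁)
    {D₂ : GeneralizedConnection 𝓔₂.courant} (hD₂ : D₂ ∈ V₂.leviCivita div₂)
    (s : ℤˣ) (e₁ e₂ : 𝓔₁.redSec) :
    V₁.ricci s D₁ e₁.1 e₂.1 x₁.1 = V₂.ricci s D₂ (ψ.sec e₁).1 (ψ.sec e₂).1 x₂.1 := by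
  have hsec := ψ.sec_redProj hV₁ hV₂ hdual.metric
  obtain ⟨Q₁, hQ₁, h₁⟩ := V₁.ricci_formula hD₁ s e₁.1 e₂.1 x₁.1
  obtain ⟨Q₂, hQ₂, h₂⟩ := V₂.ricci_formula hD₂ s (ψ.sec e₁).1 (ψ.sec e₂).1 x₂.1
  rw [h₁, h₂]
  have hb : 𝓔₁.bundle.proj x₁.1 = 𝓔₂.bundle.proj x₂.1 := x₁.2.trans x₂.2.symm
  have hdiv (e : 𝓔₁.redSec) : div₁.toFun e.1 x₁.1 = div₂.toFun (ψ.sec e).1 x₂.1 := by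
    obtain ⟨g, hg₁, hg₂⟩ := hdual.divergence e
    rw [hg₁, hg₂, hb]
  -- Both divergences are pull-backs of one function on B, smooth because its pull-back is; both
  -- sides differentiate it along the same vector of the base.
  have hderiv (a e : 𝓔₁.redSec) :
      dirDeriv (div₁.toFun e.1) x₁.1 (𝓔₁.courant.anchor x₁.1 (a.1 x₁.1)) =
        dirDeriv (div₂.toFun (ψ.sec e).1) x₂.1
          (𝓔₂.courant.anchor x₂.1 ((ψ.sec a).1 x₂.1)) := by
    obtain ⟨g, hg₁, hg₂⟩ := hdual.divergence e
    have hf₁ : ⇑(div₁.toFun e.1) = fun x => g (𝓔₁.bundle.proj x) := funext hg₁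
    have hf₂ : ⇑(div₂.toFun (ψ.sec e).1) = fun x => g (𝓔₂.bundle.proj x) := funext hg₂
    have hg : ContMDiff (𝓡 n) 𝓘(ℝ, ℝ) ∞ g :=
      𝓔₁.contMDiff_of_comp_proj (hf₁ ▸ (div₁.toFun e.1).contMDiff)
    rw [hf₁, hf₂, 𝓔₁.dirDeriv_comp_proj hg, 𝓔₂.dirDeriv_comp_proj hg,
      ← ψ.fibreEquiv_apply x₁ x₂, ψ.baseAnchor_fibreEquiv, hb]
  -- Invariant sections fill the fibre, so it suffices to test on them. There Q consists of brackets
  -- and projections, which `ψ` preserves.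
  have hQ : Q₂ = (ψ.fibreEquiv x₁ x₂).conj Q₁ := by
    ext v
    obtain ⟨u, rfl⟩ := (ψ.fibreEquiv x₁ x₂).surjective v
    obtain ⟨d, rfl⟩ := 𝓔₁.exists_redSec x₁.1 u
    rw [LinearEquiv.conj_apply_apply, LinearEquiv.symm_apply_apply, hQ₁, ψ.fibreEquiv_apply, hQ₂]
    have h := ψ.fibreEquiv_apply x₁ x₂ (𝓔₁.redProj hV₁ s (𝓔₁.redBracket (𝓔₁.redProj hV₁ (-s)
      (𝓔₁.redBracket (𝓔₁.redProj hV₁ s d) (𝓔₁.redProj hV₁ (-s) e₁))) (𝓔₁.redProj hV₁ s e₂)))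
    simp only [hsec, ψ.bracket] at h
    exact h.symm
  have hb1 := hdiv (𝓔₁.redProj hV₁ s
    (𝓔₁.redBracket (𝓔₁.redProj hV₁ (-s) e₁) (𝓔₁.redProj hV₁ s e₂)))
  have hb2 := hderiv (𝓔₁.redProj hV₁ (-s) e₁) (𝓔₁.redProj hV₁ s e₂)
  simp only [hsec, ψ.bracket] at hb1 hb2
  rw [hQ, LinearMap.trace_conj']
  exact congrArg₂ (fun p q => p - q - LinearMap.trace ℝ (E₁ x₁.1) Q₁) hb1 hb2

/-- `ricci_eq` compares any point over b on one side with any point over b on the other. Passing to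
the other side and back shows constancy along orbits, even though the connections need not be
invariant. -/
theorem equalPushforward_ricci {div₁ : DivergenceOperator 𝓔₁.courant}
    {div₂ : DivergenceOperator 𝓔₂.courant}
    (hV₁ : 𝓔₁.InvariantMetric V₁) (hV₂ : 𝓔₂.InvariantMetric V₂)
    (hdual : DualPairs ψ V₁ div₁ V₂ div₂)
    {D₁ : GeneralizedConnection 𝓔₁.courant} (hD₁ : D₁ ∈ V₁.leviCivita div₁)
    {D₂ : GeneralizedConnection 𝓔₂.courant} (hD₂ : D₂ ∈ V₂.leviCivita div₂)
    (s : ℤˣ) (e₁ e₂ : 𝓔₁.redSec) :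
    EqualPushforward 𝓔₁ 𝓔₂ (V₁.ricci s D₁ e₁.1 e₂.1)
      (V₂.ricci s D₂ (ψ.sec e₁).1 (ψ.sec e₂).1) := by
  have key (b : B) (x₁ : {x // 𝓔₁.bundle.proj x = b}) (x₂ : {x // 𝓔₂.bundle.proj x = b}) :=
    ψ.ricci_eq x₁ x₂ hV₁ hV₂ hdual hD₁ hD₂ s e₁ e₂
  refine ⟨fun b => V₁.ricci s D₁ e₁.1 e₂.1 (𝓔₁.bundle.pt b).1, fun x => ?_, fun y => ?_⟩
  · exact (key _ ⟨x, rfl⟩ (𝓔₂.bundle.pt _)).trans (key _ (𝓔₁.bundle.pt _) _).symm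
  · exact (key _ (𝓔₁.bundle.pt _) ⟨y, rfl⟩).symm

end DualityIso

end DualityRicci

/-! ### Construction of compatible generalized connections; skew-symmetry of the torsion. -/

section Existence

variable {m : ℕ} {M : Type*} [TopologicalSpace M] [ChartedSpace (EuclideanSpace ℝ (Fin m)) M]
  [IsManifold (𝓡 m) ∞ M] [T2Space M]
  {F : Type*} [NormedAddCommGroup F] [NormedSpace ℝ F] [FiniteDimensional ℝ F]
  {E : M → Type*} [TopologicalSpace (TotalSpace F E)] [∀ x, TopologicalSpace (E x)]
  [FiberBundle F E] [∀ x, AddCommGroup (E x)] [∀ x, Module ℝ (E x)] [VectorBundle ℝ F E]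
  [ContMDiffVectorBundle ∞ F E (𝓡 m)]

variable (C : CourantAlgebroid m F E)

/-- The vector that represents a functional on a fibre with respect to the pairing. -/
theorem CourantAlgebroid.exists_sharp (x : M) :
    ∃ S : (E x →ₗ[ℝ] ℝ) →ₗ[ℝ] E x, ∀ φ w, C.pairing x (S φ) w = φ w := by
  have hfin := fibre_finite F E x
  have hinj : Function.Injective (C.pairing x) :=
    (injective_iff_map_eq_zero _).mpr fun v hv => C.pairing_nondeg x v fun w => by rw [hv]; rfl
  let e := LinearMap.linearEquivOfInjective (C.pairing x) hinj
    (Subspace.dual_finrank_eq (K := ℝ) (V := E x)).symm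
  refine ⟨e.symm.toLinearMap, fun φ w => ?_⟩
  have h : e (e.symm φ) = φ := e.apply_symm_apply φ
  exact congrArg (fun ψ : E x →ₗ[ℝ] ℝ => ψ w) h

/-- The isomorphism from the dual of a fibre to the fibre that is given by the pairing. -/
def CourantAlgebroid.sharp (x : M) : (E x →ₗ[ℝ] ℝ) →ₗ[ℝ] E x := (C.exists_sharp x).choose

@[simp] theorem CourantAlgebroid.pairing_sharp (x : M) (φ : E x →ₗ[ℝ] ℝ) (w : E x) :
    C.pairing x (C.sharp x φ) w = φ w := (C.exists_sharp x).choose_spec φ w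

theorem CourantAlgebroid.ext_pairing {x : M} {u v : E x}
    (h : ∀ w, C.pairing x u w = C.pairing x v w) : u = v := by
  rw [← sub_eq_zero]
  exact C.pairing_nondeg x _ fun w => by rw [map_sub, LinearMap.sub_apply, h, sub_self]

/-- A connection along the anchor, without a compatibility with the pairing. -/
structure AnchoredConnection where
  nabla : Sec m F E → ∀ x, E x →ₗ[ℝ] E x
  smooth : ∀ (e₁ e₂ : Sec m F E) x, SmoothSecAt m F (fun x => nabla e₂ x (e₁ x)) x
  map_add : ∀ e₁ e₂ x, nabla (e₁ + e₂) x = nabla e₁ x + nabla e₂ x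
  leibniz : ∀ (f : C^∞⟮𝓡 m, M; ℝ⟯) (e : Sec m F E) x v,
    nabla (fsmul f e) x v = dirDeriv f x (C.anchor x v) • e x + f x • nabla e x v

theorem mdifferentiableAt_of_smooth {f : M → ℝ} {x : M}
    (h : ContMDiffAt (𝓡 m) 𝓘(ℝ, ℝ) ∞ f x) : MDifferentiableAt (𝓡 m) 𝓘(ℝ, ℝ) f x :=
  h.mdifferentiableAt (by simp)

/-- Each local frame has a flat connection that differentiates coefficients along the anchor. A
partition of unity glues them, and the Leibniz rule survives because the weights sum to 1. -/
theorem exists_anchoredConnection [SigmaCompactSpace M] : Nonempty (AnchoredConnection C) := by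
  choose U r s c hU hxU hsc hcs hsm using exists_frame m F E
  obtain ⟨ρ, hρ⟩ := SmoothPartitionOfUnity.exists_isSubordinate (𝓡 m) (s := Set.univ)
    isClosed_univ U hU fun x _ => Set.mem_iUnion.mpr ⟨x, hxU x⟩
  -- Nothing is controlled outside `U i`, where the weight `ρ i` vanishes.
  let loc (i : M) (e : Sec m F E) (x : M) : E x →ₗ[ℝ] E x :=
    ∑ j, ((mvfderiv (𝓡 m) (fun y => c i j y (e y)) x).toLinearMap ∘ₗ C.anchor x).smulRight (s i j x)
  have hloc (i e x v) : loc i e x v =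
      ∑ j, dirDeriv (fun y => c i j y (e y)) x (C.anchor x v) • s i j x := by
    simp only [loc, LinearMap.sum_apply, LinearMap.smulRight_apply]
    rfl
  have hcsm (i) (e : Sec m F E) (j) (y) (hy : y ∈ U i) :
      ContMDiffAt (𝓡 m) 𝓘(ℝ, ℝ) ∞ (fun z => c i j z (e z)) y :=
    (hsm i _ y hy).mp (e.smoothAt y) j
  have hmem (i x) (hi : i ∈ ρ.finsupport x) : x ∈ U i := by
    refine hρ i (subset_closure ?_)
    simpa using hi
  refine ⟨⟨fun e x => ∑ i ∈ ρ.finsupport x, ρ i x • loc i e x, fun e₁ e₂ => ?_, fun e₁ e₂ x => ?_,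
    fun f e x v => ?_⟩⟩
  · have h1 : (fun x => TotalSpace.mk' F x
        ((∑ i ∈ ρ.finsupport x, ρ i x • loc i e₂ x) (e₁ x))) =
        fun x => TotalSpace.mk' F x (∑ᶠ i, ρ i x • loc i e₂ x (e₁ x)) := by
      funext x
      congr 1
      rw [← ρ.sum_finsupport_smul_eq_finsum x (fun i _ => loc i e₂ x (e₁ x)), LinearMap.sum_apply]
      rfl
    change ContMDiff (𝓡 m) ((𝓡 m).prod 𝓘(ℝ, F)) ∞ _
    rw [h1]
    refine ContMDiff.finsum_section_of_locallyFinite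
      (ρ.locallyFinite.subset fun i x hx => left_ne_zero_of_smul hx) fun i => ?_
    refine ContMDiffOn.smul_section_of_tsupport (ρ i).contMDiff.contMDiffOn (hU i) (hρ i) ?_
    refine ContMDiffOn.congr (f := fun x => TotalSpace.mk' F x
      (∑ j, dirDeriv (fun y => c i j y (e₂ y)) x (C.anchor x (e₁ x)) • s i j x)) ?_
      fun x _ => by rw [hloc]
    refine ContMDiffOn.sum_section fun j _ => ?_
    refine ContMDiffOn.smul_section (fun x hx => ?_) (s i j).contMDiff.contMDiffOn
    exact (contMDiffAt_dirDeriv (hU i) hx (hcsm i e₂ j)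
      (C.anchor_smooth e₁)).contMDiffWithinAt
  · rw [← Finset.sum_add_distrib]
    refine Finset.sum_congr rfl fun i hi => ?_
    rw [← smul_add]
    congr 1
    ext v
    rw [LinearMap.add_apply, hloc, hloc, hloc, ← Finset.sum_add_distrib]
    refine Finset.sum_congr rfl fun j _ => ?_
    rw [← add_smul, ← dirDeriv_add (mdifferentiableAt_of_smooth (hcsm i e₁ j x (hmem i x hi)))
      (mdifferentiableAt_of_smooth (hcsm i e₂ j x (hmem i x hi)))]
    simp only [Sec.add_apply, _root_.map_add]
  · have h1 (i) (hi : i ∈ ρ.finsupport x) : loc i (fsmul f e) x v =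
        dirDeriv f x (C.anchor x v) • e x + f x • loc i e x v := by
      have hx := hmem i x hi
      conv_rhs => rw [hsc i x hx (e x)]
      rw [hloc, hloc, Finset.smul_sum, Finset.smul_sum, ← Finset.sum_add_distrib]
      refine Finset.sum_congr rfl fun j _ => ?_
      have h2 := dirDeriv_mul (f.contMDiff.mdifferentiable (by simp) x)
        (mdifferentiableAt_of_smooth (hcsm i e j x hx)) (C.anchor x v)
      have h3 : (fun y => c i j y (fsmul f e y)) = fun y => f y * c i j y (e y) := by
        funext y
        rw [fsmul_apply, _root_.map_smul, smul_eq_mul]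
      rw [h3, h2]
      module
    have h2 := ρ.sum_finsupport x (Set.mem_univ x)
    simp only [LinearMap.sum_apply, LinearMap.smul_apply]
    rw [Finset.sum_congr rfl fun i hi => congrArg (ρ i x • ·) (h1 i hi)]
    simp only [smul_add, Finset.sum_add_distrib]
    rw [← Finset.sum_smul, h2, one_smul, Finset.smul_sum]
    congr 1
    exact Finset.sum_congr rfl fun i _ => smul_comm _ _ _

variable {C}

theorem dirDeriv_pairing_fsmul (f : C^∞⟮𝓡 m, M; ℝ⟯) (e c : Sec m F E) (x : M)
    (v : TangentSpace (𝓡 m) x) :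
    dirDeriv (fun y => C.pairing y (e y) (fsmul f c y)) x v =
      f x * dirDeriv (fun y => C.pairing y (e y) (c y)) x v +
        dirDeriv f x v * C.pairing x (e x) (c x) := by
  rw [← dirDeriv_mul (f.contMDiff.mdifferentiable (by simp) x)
    ((C.pairing_smooth e c).mdifferentiable (by simp) x)]
  simp only [fsmul_apply, _root_.map_smul, smul_eq_mul]

theorem dirDeriv_pairing_add (e c c' : Sec m F E) (x : M) (v : TangentSpace (𝓡 m) x) :
    dirDeriv (fun y => C.pairing y (e y) ((c + c') y)) x v =
      dirDeriv (fun y => C.pairing y (e y) (c y)) x v +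
        dirDeriv (fun y => C.pairing y (e y) (c' y)) x v := by
  rw [← dirDeriv_add ((C.pairing_smooth e c).mdifferentiable (by simp) x)
    ((C.pairing_smooth e c').mdifferentiable (by simp) x)]
  simp only [Sec.add_apply, _root_.map_add]

/-- The average of a connection and its adjoint is compatible with the pairing. -/
theorem AnchoredConnection.exists_metric (A : AnchoredConnection C) :
    Nonempty (GeneralizedConnection C) := by
  -- The adjoint connection. Its defining expression is tensorial in `c` because the two derivatives
  -- of a coefficient function cancel.
  have hex (e : Sec m F E) (x : M) : ∃ N : E x →ₗ[ℝ] E x, ∀ v (c : Sec m F E),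
      C.pairing x (N v) (c x) = dirDeriv (fun y => C.pairing y (e y) (c y)) x (C.anchor x v) -
        C.pairing x (e x) (A.nabla c x v) := by
    obtain ⟨L, hL⟩ := exists_fibreMap (m := m) (F := F) (E := E) (A := E x →ₗ[ℝ] ℝ) x
      (fun c => (mvfderiv (𝓡 m) (fun y => C.pairing y (e y) (c y)) x).toLinearMap ∘ₗ C.anchor x -
        C.pairing x (e x) ∘ₗ A.nabla c x)
      (fun c c' => by
        ext v
        have := dirDeriv_pairing_add (C := C) e c c' x (C.anchor x v)
        change dirDeriv _ x _ - C.pairing x (e x) (A.nabla (c + c') x v) =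
          (dirDeriv _ x _ - C.pairing x (e x) (A.nabla c x v)) +
            (dirDeriv _ x _ - C.pairing x (e x) (A.nabla c' x v))
        rw [this, A.map_add, LinearMap.add_apply, _root_.map_add]
        ring)
      (fun f c => by
        ext v
        have := dirDeriv_pairing_fsmul (C := C) f e c x (C.anchor x v)
        change dirDeriv _ x _ - C.pairing x (e x) (A.nabla (fsmul f c) x v) =
          f x * (dirDeriv _ x _ - C.pairing x (e x) (A.nabla c x v))
        rw [this, A.leibniz, _root_.map_add, _root_.map_smul, _root_.map_smul, smul_eq_mul,
          smul_eq_mul]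
        ring)
    refine ⟨C.sharp x ∘ₗ L.flip, fun v c => ?_⟩
    rw [LinearMap.comp_apply, C.pairing_sharp, LinearMap.flip_apply, hL]
    rfl
  choose N hN using hex
  have hN' (e : Sec m F E) (x : M) (v w : E x) (c : Sec m F E) (hc : c x = w) :
      C.pairing x (N e x v) w = dirDeriv (fun y => C.pairing y (e y) (c y)) x (C.anchor x v) -
        C.pairing x (e x) (A.nabla c x v) := hc ▸ hN e x v c
  have hNsm (e₁ e₂ : Sec m F E) (x : M) : SmoothSecAt m F (fun x => N e₂ x (e₁ x)) x := by
    refine smoothSecAt_of_pairing C _ (fun c => ?_) x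
    simp only [hN]
    exact (contMDiff_dirDeriv (C.pairing_smooth e₂ c) (C.anchor_smooth e₁)).sub
      (C.pairing_smooth e₂ ⟨_, A.smooth e₁ c⟩)
  refine ⟨⟨fun e x => (1 / 2 : ℝ) • (A.nabla e x + N e x), fun e₁ e₂ x => ?_, fun e₁ e₂ x => ?_,
    fun f e x v => ?_, fun e₁ e₂ x v => ?_⟩⟩
  · exact ContMDiffAt.const_smul_section (a := (1 / 2 : ℝ))
      ((A.smooth e₁ e₂ x).add_section (hNsm e₁ e₂ x))
  · have h : N (e₁ + e₂) x = N e₁ x + N e₂ x := by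
      ext v
      refine C.ext_pairing fun w => ?_
      obtain ⟨c, hc⟩ := exists_sec (m := m) (F := F) (E := E) x w
      simp only [LinearMap.add_apply, _root_.map_add, hN' _ x v w c hc]
      simp only [C.pairing_symm _ _ (c _)]
      rw [dirDeriv_pairing_add, Sec.add_apply, _root_.map_add, LinearMap.add_apply]
      ring
    rw [h, A.map_add]
    module
  · have h : N (fsmul f e) x v = dirDeriv f x (C.anchor x v) • e x + f x • N e x v := by
      refine C.ext_pairing fun w => ?_
      obtain ⟨c, hc⟩ := exists_sec (m := m) (F := F) (E := E) x w
      simp only [LinearMap.add_apply, _root_.map_add, _root_.map_smul, LinearMap.smul_apply,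
        hN' _ x v w c hc]
      simp only [C.pairing_symm _ _ (c _)]
      rw [dirDeriv_pairing_fsmul, fsmul_apply, _root_.map_smul, LinearMap.smul_apply, ← hc,
        C.pairing_symm x (e x) (c x)]
      simp only [smul_eq_mul]
      ring
    rw [LinearMap.smul_apply, LinearMap.add_apply, h, A.leibniz, LinearMap.smul_apply,
      LinearMap.add_apply]
    module
  · have h1 := hN e₁ x v e₂
    have h2 := hN e₂ x v e₁
    have h3 : (fun y => C.pairing y (e₂ y) (e₁ y)) = fun y => C.pairing y (e₁ y) (e₂ y) :=
      funext fun y => C.pairing_symm y _ _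
    rw [h3, C.pairing_symm, C.pairing_symm x (e₂ x)] at h2
    simp only [LinearMap.smul_apply, LinearMap.add_apply, _root_.map_add, _root_.map_smul,
      smul_eq_mul, h1, h2]
    ring

namespace GeneralizedConnection

theorem nabla_zero (D : GeneralizedConnection C) (x : M) : D.nabla 0 x = 0 := by
  have h := D.map_add 0 0 x
  rwa [add_zero, left_eq_add] at h

variable (D : GeneralizedConnection C)

/-- A generalized connection that is compatible with a given generalized metric. -/
def compress (V : GeneralizedMetric C) : GeneralizedConnection C where
  nabla e x := V.proj 1 x ∘ₗ D.nabla (V.projSec 1 e) x +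
    V.proj (-1) x ∘ₗ D.nabla (V.projSec (-1) e) x
  smooth e₁ e₂ := (V.projSec 1 (D.cov e₁ (V.projSec 1 e₂)) +
    V.projSec (-1) (D.cov e₁ (V.projSec (-1) e₂))).contMDiff
  map_add e₁ e₂ x := by
    simp only [V.projSec_add, D.map_add, LinearMap.comp_add]
    abel
  leibniz f e x v := by
    have h := V.proj_add_proj 1 x (e x)
    simp only [V.projSec_fsmul, LinearMap.add_apply, LinearMap.comp_apply, D.leibniz,
      _root_.map_add, _root_.map_smul, V.proj_eq (V.projSec_mem _ e x)]
    conv_rhs => rw [← h]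
    change dirDeriv f x _ • V.proj 1 x (e x) + _ + (dirDeriv f x _ • V.proj (-1) x (e x) + _) = _
    module
  metric e₁ e₂ x v := by
    -- By orthogonality there are no cross terms, so metricity of `D` is applied to each component
    -- separately.
    have h : (fun y => C.pairing y (e₁ y) (e₂ y)) = fun y =>
        C.pairing y (V.projSec 1 e₁ y) (V.projSec 1 e₂ y) +
          C.pairing y (V.projSec (-1) e₁ y) (V.projSec (-1) e₂ y) := by
      funext y
      change _ = C.pairing y (V.proj 1 y (e₁ y)) (V.proj 1 y (e₂ y)) +
        C.pairing y (V.proj (-1) y (e₁ y)) (V.proj (-1) y (e₂ y))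
      rw [V.pairing_proj_left, V.pairing_proj_left, V.proj_proj, V.proj_proj, ← _root_.map_add,
        V.proj_add_proj]
    rw [h, dirDeriv_add ((C.pairing_smooth _ _).mdifferentiable (by simp) x)
      ((C.pairing_smooth _ _).mdifferentiable (by simp) x), D.metric, D.metric]
    simp only [LinearMap.add_apply, LinearMap.comp_apply, _root_.map_add, V.pairing_proj_left]
    simp only [← V.pairing_proj_left]
    change C.pairing x _ (V.proj 1 x (e₂ x)) + C.pairing x (V.proj 1 x (e₁ x)) _ +
      (C.pairing x _ (V.proj (-1) x (e₂ x)) + C.pairing x (V.proj (-1) x (e₁ x)) _) = _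
    simp only [← V.pairing_proj_left]
    ring

theorem compress_compatible (V : GeneralizedMetric C) : V.Compatible (D.compress V) := by
  intro s e he x v
  have h0 : V.projSec (-s) e = 0 := by
    ext y
    exact V.proj_eq_zero (by rw [neg_neg]; exact he y)
  change V.proj 1 x (D.nabla (V.projSec 1 e) x v) +
    V.proj (-1) x (D.nabla (V.projSec (-1) e) x v) ∈ _
  rcases Int.units_eq_one_or s with rfl | rfl
  · rw [h0, nabla_zero, LinearMap.zero_apply, _root_.map_zero, add_zero]
    exact V.proj_mem _ _ _
  · rw [neg_neg] at h0
    rw [h0, nabla_zero, LinearMap.zero_apply, _root_.map_zero, zero_add]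
    exact V.proj_mem _ _ _

/-- The sum of a generalized connection and a skew-symmetric tensor. -/
def addTensor (A : ∀ x, E x →ₗ[ℝ] E x →ₗ[ℝ] E x)
    (hsm : ∀ (a b : Sec m F E) x, SmoothSecAt m F (fun y => A y (a y) (b y)) x)
    (hskew : ∀ x v w u, C.pairing x (A x v w) u + C.pairing x w (A x v u) = 0) :
    GeneralizedConnection C where
  nabla e x := D.nabla e x + (A x).flip (e x)
  smooth e₁ e₂ x := ContMDiffAt.add_section (D.smooth e₁ e₂ x) (hsm e₁ e₂ x)
  map_add e₁ e₂ x := by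
    rw [D.map_add, Sec.add_apply, _root_.map_add]
    abel
  leibniz f e x v := by
    simp only [LinearMap.add_apply, D.leibniz, fsmul_apply, _root_.map_smul, LinearMap.smul_apply]
    module
  metric e₁ e₂ x v := by
    have h := hskew x v (e₁ x) (e₂ x)
    simp only [D.metric, LinearMap.add_apply, _root_.map_add, LinearMap.flip_apply]
    linarith

theorem torsion_addTensor (A : ∀ x, E x →ₗ[ℝ] E x →ₗ[ℝ] E x) (hsm) (hskew)
    (a b c : Sec m F E) (x : M) :
    (D.addTensor A hsm hskew).torsion a b c x = D.torsion a b c x +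
      (C.pairing x (A x (a x) (b x)) (c x) - C.pairing x (A x (b x) (a x)) (c x) +
        C.pairing x (A x (c x) (a x)) (b x)) := by
  unfold torsion
  have h (a b : Sec m F E) : (D.addTensor A hsm hskew).cov a b x =
    D.cov a b x + A x (a x) (b x) := rfl
  simp only [Sec.sub_apply, h, _root_.map_sub, _root_.map_add, LinearMap.sub_apply,
    LinearMap.add_apply]
  ring

/-- Polarizing 2[e,e] = π^*d⟨e,e⟩ gives the symmetric part of the bracket, which metricity of `D`
cancels. -/
theorem torsion_swap₁₂ (a b c : Sec m F E) (x : M) :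
    D.torsion b a c x = -D.torsion a b c x := by
  have hm := D.metric a b x (c x)
  have hs (e : Sec m F E) := C.bracket_self e x (c x)
  have hadd := hs (a + b)
  have hd : dirDeriv (fun y => C.pairing y ((a + b) y) ((a + b) y)) x (C.anchor x (c x)) =
      dirDeriv (fun y => C.pairing y (a y) (a y)) x (C.anchor x (c x)) +
      2 * dirDeriv (fun y => C.pairing y (a y) (b y)) x (C.anchor x (c x)) +
      dirDeriv (fun y => C.pairing y (b y) (b y)) x (C.anchor x (c x)) := by
    rw [dirDeriv_pairing_add]
    simp only [C.pairing_symm _ ((a + b) _)]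
    rw [dirDeriv_pairing_add, dirDeriv_pairing_add]
    simp only [C.pairing_symm _ (b _) (a _)]
    ring
  rw [hd, ← hs a, ← hs b, hm] at hadd
  simp only [_root_.map_add, LinearMap.add_apply, Sec.add_apply] at hadd
  unfold torsion
  simp only [Sec.sub_apply, _root_.map_sub, LinearMap.sub_apply]
  have e1 : C.pairing x (a x) (D.nabla b x (c x)) = C.pairing x (D.cov c b x) (a x) :=
    C.pairing_symm x _ _
  have e2 : C.pairing x (D.nabla a x (c x)) (b x) = C.pairing x (D.cov c a x) (b x) := rfl
  rw [e1, e2] at hadd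
  linarith

/-- Both the bracket and `D` differentiate the pairing ⟨b,c⟩ along the anchor of `a`; the difference
of the two identities is the claim. -/
theorem torsion_swap₂₃ (a b c : Sec m F E) (x : M) :
    D.torsion a c b x = -D.torsion a b c x := by
  have hm := D.metric b c x (a x)
  have hb := C.anchor_pairing a b c x
  unfold torsion
  simp only [Sec.sub_apply, _root_.map_sub, LinearMap.sub_apply]
  have e1 : C.pairing x (b x) (D.nabla c x (a x)) = C.pairing x (D.cov a c x) (b x) :=
    C.pairing_symm x _ _
  have e2 : C.pairing x (D.nabla b x (a x)) (c x) = C.pairing x (D.cov a b x) (c x) := rfl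
  rw [e1, e2] at hm
  rw [C.pairing_symm x (b x)] at hb
  linarith

/-- The torsion as a smooth field of skew-symmetric maps. -/
theorem exists_torsionTensor : ∃ Θ : ∀ x, E x →ₗ[ℝ] E x →ₗ[ℝ] E x,
    (∀ (a b : Sec m F E) x, SmoothSecAt m F (fun y => Θ y (a y) (b y)) x) ∧
    (∀ (a b c : Sec m F E) x, C.pairing x (Θ x (a x) (b x)) (c x) = D.torsion a b c x) := by
  have hex (a b : Sec m F E) (x : M) : ∃ t : E x, ∀ c : Sec m F E,
      C.pairing x t (c x) = D.torsion a b c x := by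
    refine ⟨(D.cov a b - D.cov b a - C.bracket a b) x +
      C.sharp x ((C.pairing x).flip (b x) ∘ₗ D.nabla a x), fun c => ?_⟩
    rw [_root_.map_add, LinearMap.add_apply, C.pairing_sharp]
    rfl
  choose t ht using hex
  have ht' (a b x w) (c : Sec m F E) (hc : c x = w) :
    C.pairing x (t a b x) w = D.torsion a b c x := hc ▸ ht a b x c
  -- Tensoriality is evident only in the last argument; skew-symmetry carries it to the other two.
  have hadd₃ (a b c c' x) : D.torsion a b (c + c') x = D.torsion a b c x + D.torsion a b c' x := by
    rw [← ht, ← ht, ← ht, Sec.add_apply, _root_.map_add]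
  have hsmul₃ (f : C^∞⟮𝓡 m, M; ℝ⟯) (a b c x) :
      D.torsion a b (fsmul f c) x = f x * D.torsion a b c x := by
    rw [← ht, ← ht, fsmul_apply, _root_.map_smul, smul_eq_mul]
  have hadd₂ (a b b' c x) : D.torsion a (b + b') c x = D.torsion a b c x + D.torsion a b' c x := by
    rw [D.torsion_swap₂₃ a c, hadd₃, D.torsion_swap₂₃ a b, D.torsion_swap₂₃ a b' c]
    ring
  have hsmul₂ (f : C^∞⟮𝓡 m, M; ℝ⟯) (a b c x) :
      D.torsion a (fsmul f b) c x = f x * D.torsion a b c x := by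
    rw [D.torsion_swap₂₃ a c, hsmul₃, D.torsion_swap₂₃ a b]
    ring
  have hadd₁ (a a' b c x) : D.torsion (a + a') b c x = D.torsion a b c x + D.torsion a' b c x := by
    rw [D.torsion_swap₁₂ b, hadd₂, D.torsion_swap₁₂ a b, D.torsion_swap₁₂ a' b]
    ring
  have hsmul₁ (f : C^∞⟮𝓡 m, M; ℝ⟯) (a b c x) :
      D.torsion (fsmul f a) b c x = f x * D.torsion a b c x := by
    rw [D.torsion_swap₁₂ b, hsmul₂, D.torsion_swap₁₂ a b]
    ring
  have hex₁ (x : M) (a : Sec m F E) : ∃ L : E x →ₗ[ℝ] E x, ∀ b : Sec m F E,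
      L (b x) = t a b x := by
    refine exists_fibreMap x (fun b => t a b x) (fun b b' => C.ext_pairing fun w => ?_)
      (fun f b => C.ext_pairing fun w => ?_) <;>
    obtain ⟨c, hc⟩ := exists_sec (m := m) (F := F) (E := E) x w <;>
    simp only [_root_.map_add, _root_.map_smul, LinearMap.add_apply, LinearMap.smul_apply,
      ht' _ _ x w c hc, smul_eq_mul, hadd₂, hsmul₂]
  choose L hL using hex₁
  have hex₂ (x : M) : ∃ Θ : E x →ₗ[ℝ] E x →ₗ[ℝ] E x, ∀ a : Sec m F E, Θ (a x) = L x a := by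
    refine exists_fibreMap x (L x) (fun a a' => ?_) (fun f a => ?_) <;>
    refine LinearMap.ext fun v => C.ext_pairing fun w => ?_ <;>
    obtain ⟨b, rfl⟩ := exists_sec (m := m) (F := F) (E := E) x v <;>
    obtain ⟨c, hc⟩ := exists_sec (m := m) (F := F) (E := E) x w <;>
    simp only [_root_.map_add, _root_.map_smul, LinearMap.add_apply, LinearMap.smul_apply, hL,
      ht' _ _ x w c hc, smul_eq_mul, hadd₁, hsmul₁]
  choose Θ hΘ using hex₂
  have key (a b c : Sec m F E) (x) : C.pairing x (Θ x (a x) (b x)) (c x) = D.torsion a b c x := by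
    rw [hΘ, hL, ht]
  refine ⟨Θ, fun a b x => smoothSecAt_of_pairing C _ (fun c => ?_) x, key⟩
  simp only [key]
  exact (C.pairing_smooth (D.cov a b - D.cov b a - C.bracket a b) c).add
    (C.pairing_smooth (D.cov c a) b)

end GeneralizedConnection

end Existence

/-! ### Correcting the torsion and the divergence. -/

section LeviCivita

variable {m : ℕ} {M : Type*} [TopologicalSpace M] [ChartedSpace (EuclideanSpace ℝ (Fin m)) M]
  [IsManifold (𝓡 m) ∞ M] [T2Space M]
  {F : Type*} [NormedAddCommGroup F] [NormedSpace ℝ F] [FiniteDimensional ℝ F]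
  {E : M → Type*} [TopologicalSpace (TotalSpace F E)] [∀ x, TopologicalSpace (E x)]
  [FiberBundle F E] [∀ x, AddCommGroup (E x)] [∀ x, Module ℝ (E x)] [VectorBundle ℝ F E]
  [ContMDiffVectorBundle ∞ F E (𝓡 m)]
  {C : CourantAlgebroid m F E}

namespace GeneralizedMetric

variable (V : GeneralizedMetric C)

/-- Subtracting suitable multiples of the components of the torsion yields a torsion-free
compatible connection. -/
theorem exists_torsionFree {D : GeneralizedConnection C} (hD : V.Compatible D) :
    ∃ D' : GeneralizedConnection C, V.Compatible D' ∧ ∀ e₁ e₂ e₃ x, D'.torsion e₁ e₂ e₃ x = 0 := by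
  obtain ⟨Θ, hΘsm, hΘ⟩ := D.exists_torsionTensor
  have h₁₂ (x : M) (u v w : E x) : C.pairing x (Θ x v u) w = -C.pairing x (Θ x u v) w := by
    obtain ⟨a, rfl⟩ := exists_sec (m := m) (F := F) (E := E) x u
    obtain ⟨b, rfl⟩ := exists_sec (m := m) (F := F) (E := E) x v
    obtain ⟨c, rfl⟩ := exists_sec (m := m) (F := F) (E := E) x w
    rw [hΘ, hΘ, D.torsion_swap₁₂]
  have h₂₃ (x : M) (u v w : E x) : C.pairing x (Θ x u w) v = -C.pairing x (Θ x u v) w := by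
    obtain ⟨a, rfl⟩ := exists_sec (m := m) (F := F) (E := E) x u
    obtain ⟨b, rfl⟩ := exists_sec (m := m) (F := F) (E := E) x v
    obtain ⟨c, rfl⟩ := exists_sec (m := m) (F := F) (E := E) x w
    rw [hΘ, hΘ, D.torsion_swap₂₃]
  -- Adding a tensor changes the torsion by three terms. On a component entirely in V_s all three
  -- equal the same multiple of Θ, whence 1/3. With exactly one argument in V_{-s} only the term
  -- having it in the first slot survives, whence weight 1. Any three arguments include two of equal
  -- sign, so the two signs cover all components.
  let A (s : ℤˣ) (x : M) : E x →ₗ[ℝ] E x →ₗ[ℝ] E x :=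
    ((Θ x).compl₁₂ ((1 / 3 : ℝ) • V.proj s x + V.proj (-s) x) (V.proj s x)).compr₂ (V.proj s x)
  have hA (s x v w) : A s x v w =
      V.proj s x (Θ x ((1 / 3 : ℝ) • V.proj s x v + V.proj (-s) x v) (V.proj s x w)) := rfl
  have hAp (s x v w u) : C.pairing x (A s x v w) u = C.pairing x
      (Θ x ((1 / 3 : ℝ) • V.proj s x v + V.proj (-s) x v) (V.proj s x w)) (V.proj s x u) := by
    rw [hA, V.pairing_proj_left]
  have hAsm (s) (a b : Sec m F E) (x) : SmoothSecAt m F (fun y => A s y (a y) (b y)) x :=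
    (V.projSec s ⟨_, hΘsm ((1 / 3 : ℝ) • V.projSec s a + V.projSec (-s) a)
      (V.projSec s b)⟩).smoothAt x
  have hAskew (s x v w u) : C.pairing x (A s x v w) u + C.pairing x w (A s x v u) = 0 := by
    rw [C.pairing_symm x w, hAp, hAp, h₂₃ x _ (V.proj s x w), add_neg_cancel]
  let D' := D.addTensor (fun x => -(A 1 x + A (-1) x))
    (fun a b x => ContMDiffAt.neg_section
      (ContMDiffAt.add_section (hAsm 1 a b x) (hAsm (-1) a b x)))
    (fun x v w u => by
      have h1 := hAskew 1 x v w u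
      have h2 := hAskew (-1) x v w u
      simp only [LinearMap.neg_apply, LinearMap.add_apply, _root_.map_neg, _root_.map_add]
      linarith)
  refine ⟨D', fun s e he x v => ?_, fun a b c x => ?_⟩
  · change D.nabla e x v + -(A 1 x v (e x) + A (-1) x v (e x)) ∈ _
    have hz : A (-s) x v (e x) = 0 := by
      have h : V.proj (-s) x (e x) = 0 := V.proj_eq_zero (by rw [neg_neg]; exact he x)
      rw [hA, h, _root_.map_zero, _root_.map_zero]
    have hm : A s x v (e x) ∈ V.sub s x := V.proj_mem s x _
    refine Submodule.add_mem _ (hD s e he x v) (Submodule.neg_mem _ ?_)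
    rcases Int.units_eq_one_or s with rfl | rfl
    · rwa [hz, add_zero]
    · rw [neg_neg] at hz
      rwa [hz, zero_add]
  · rw [D.torsion_addTensor, ← hΘ]
    simp only [LinearMap.neg_apply, LinearMap.add_apply, _root_.map_neg, _root_.map_add, hAp,
      neg_neg]
    have ha := V.proj_add_proj 1 x (a x)
    have hb := V.proj_add_proj 1 x (b x)
    have hc := V.proj_add_proj 1 x (c x)
    have hrot (u v w : E x) : C.pairing x (Θ x w u) v = C.pairing x (Θ x u v) w := by
      rw [h₁₂ x u w v, h₂₃ x u v w, neg_neg]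
    have hz (v : E x) : V.proj (-1) x (V.proj 1 x v) = 0 :=
      V.proj_eq_zero (by rw [neg_neg]; exact V.proj_mem 1 x v)
    rw [← ha, ← hb, ← hc]
    simp only [_root_.map_add, V.proj_proj, V.proj_eq_zero (s := 1) (V.proj_mem (-1) x _),
      hz, add_zero, zero_add]
    generalize V.proj 1 x (a x) = a₁
    generalize V.proj (-1) x (a x) = a₂
    generalize V.proj 1 x (b x) = b₁
    generalize V.proj (-1) x (b x) = b₂
    generalize V.proj 1 x (c x) = c₁
    generalize V.proj (-1) x (c x) = c₂
    simp only [_root_.map_add, _root_.map_smul, LinearMap.add_apply, LinearMap.smul_apply,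
      smul_eq_mul, h₁₂ x a₁ b₁, h₁₂ x a₁ b₂, h₁₂ x a₂ b₁, h₁₂ x a₂ b₂,
      hrot a₁ b₁, hrot a₂ b₂]
    ring

theorem trace_proj (s : ℤˣ) (x : M) :
    LinearMap.trace ℝ (E x) (V.proj s x) = Module.finrank ℝ (V.sub s x) := by
  have hfin := fibre_finite F E x
  have h : LinearMap.IsProj (V.sub s x) (V.proj s x) := ⟨V.proj_mem s x, fun v hv => V.proj_eq hv⟩
  exact h.trace

/-- Over bundles `V_±` without rank `1`, every divergence operator is the divergence of a
torsion-free compatible connection. -/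
theorem leviCivita_nonempty [SigmaCompactSpace M] (dv : DivergenceOperator C)
    (hrank : ∀ s x, Module.finrank ℝ (V.sub s x) ≠ 1) : (V.leviCivita dv).Nonempty := by
  have hfin (x) := fibre_finite F E x
  obtain ⟨A₀⟩ := exists_anchoredConnection C
  obtain ⟨D₀⟩ := A₀.exists_metric
  obtain ⟨D, hD, hT⟩ := V.exists_torsionFree (D₀.compress_compatible V)
  -- Both divergences obey the same Leibniz rule, so their difference is tensorial; ε below
  -- represents it through the pairing.
  have hex (x : M) : ∃ L : E x →ₗ[ℝ] ℝ, ∀ e : Sec m F E,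
      L (e x) = dv.toFun e x - D.divergence e x := by
    refine exists_fibreMap x (fun e => dv.toFun e x - D.divergence e x) (fun e e' => ?_)
      fun f e => ?_
    · simp only [dv.map_add, GeneralizedConnection.divergence, D.map_add, _root_.map_add,
        ContMDiffMap.coe_add, Pi.add_apply]
      ring
    · have h : D.nabla (fsmul f e) x = ((mvfderiv (𝓡 m) f x).toLinearMap ∘ₗ
          C.anchor x).smulRight (e x) + f x • D.nabla e x := by
        ext v
        rw [D.leibniz]
        rfl
      simp only [GeneralizedConnection.divergence, h, dv.leibniz, _root_.map_add, _root_.map_smul,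
        LinearMap.trace_smulRight, smul_eq_mul]
      change dirDeriv f x (C.anchor x (e x)) + _ - (dirDeriv f x (C.anchor x (e x)) + _) = _
      ring
  choose L hL using hex
  have hdivsm (e : Sec m F E) : ContMDiff (𝓡 m) 𝓘(ℝ, ℝ) ∞ (D.divergence e) :=
    contMDiff_trace _ fun a x => D.smooth a e x
  let ε : Sec m F E := ⟨fun x => C.sharp x (L x), fun x => smoothSecAt_of_pairing C _ (fun e => by
    simp only [C.pairing_sharp, hL]
    exact (dv.toFun e).contMDiff.sub (hdivsm e)) x⟩
  have hε (x : M) (w : E x) : C.pairing x (ε x) w = L x w := C.pairing_sharp x _ _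
  have hr (s : ℤˣ) (x : M) : 1 - LinearMap.trace ℝ (E x) (V.proj s x) ≠ 0 := by
    rw [V.trace_proj, sub_ne_zero]
    exact_mod_cast (hrank s x).symm
  -- This is 1/(1 - rank V_s). Writing the rank as the trace of a smooth projection gives its
  -- smoothness directly.
  let κ (s : ℤˣ) : C^∞⟮𝓡 m, M; ℝ⟯ := ⟨fun x => (1 - LinearMap.trace ℝ (E x) (V.proj s x))⁻¹,
    (contMDiff_const.sub (contMDiff_trace _ fun e x => (V.projSec s e).smoothAt x)).inv₀ (hr s)⟩
  let W (s : ℤˣ) (x : M) : E x →ₗ[ℝ] E x →ₗ[ℝ] E x :=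
    LinearMap.mk₂ ℝ (fun v w => κ s x • (C.pairing x (V.proj s x v) w • V.proj s x (ε x) -
        C.pairing x (ε x) (V.proj s x w) • V.proj s x v))
      (fun v v' w => by simp only [_root_.map_add, LinearMap.add_apply]; module)
      (fun r v w => by simp only [_root_.map_smul, LinearMap.smul_apply, smul_eq_mul]; module)
      (fun v w w' => by simp only [_root_.map_add]; module)
      (fun r v w => by simp only [_root_.map_smul, smul_eq_mul]; module)
  have hW (s x v w) : W s x v w = κ s x • (C.pairing x (V.proj s x v) w • V.proj s x (ε x) -
      C.pairing x (ε x) (V.proj s x w) • V.proj s x v) := rfl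
  have hWp (s x v w u) : C.pairing x (W s x v w) u = κ s x *
      (C.pairing x (V.proj s x v) w * C.pairing x (V.proj s x (ε x)) u -
        C.pairing x (V.proj s x (ε x)) w * C.pairing x (V.proj s x v) u) := by
    simp only [hW, _root_.map_smul, _root_.map_sub, LinearMap.smul_apply, LinearMap.sub_apply,
      smul_eq_mul, V.pairing_proj_left s x (ε x) w]
  have hWsm (s) (a b : Sec m F E) (x) : SmoothSecAt m F (fun y => W s y (a y) (b y)) x :=
    (fsmul (κ s) (fsmul ⟨_, C.pairing_smooth (V.projSec s a) b⟩ (V.projSec s ε) -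
      fsmul ⟨_, C.pairing_smooth ε (V.projSec s b)⟩ (V.projSec s a))).smoothAt x
  -- The first summand of W has trace L(w^s) and the second rank(V_s) L(w^s), before the
  -- normalization κ.
  have hWtr (s x w) : LinearMap.trace ℝ (E x) ((W s x).flip w) = L x (V.proj s x w) := by
    have h : (W s x).flip w = κ s x • (((C.pairing x).flip w ∘ₗ V.proj s x).smulRight
        (V.proj s x (ε x)) - C.pairing x (ε x) (V.proj s x w) • V.proj s x) := rfl
    have hf : (C.pairing x).flip w (V.proj s x (ε x)) =
        C.pairing x (V.proj s x (ε x)) w := rfl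
    have hκ : κ s x = (1 - LinearMap.trace ℝ (E x) (V.proj s x))⁻¹ := rfl
    rw [h, _root_.map_smul, _root_.map_sub, LinearMap.trace_smulRight, _root_.map_smul,
      LinearMap.comp_apply, V.proj_proj, hf, V.pairing_proj_left, hε, hκ,
      smul_eq_mul, smul_eq_mul, inv_mul_eq_iff_eq_mul₀ (hr s x)]
    ring
  refine ⟨D.addTensor (fun x => W 1 x + W (-1) x)
    (fun a b x => ContMDiffAt.add_section (hWsm 1 a b x) (hWsm (-1) a b x))
    (fun x v w u => by
      simp only [LinearMap.add_apply, _root_.map_add, C.pairing_symm x w, hWp]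
      ring), fun s e he x v => ?_, fun a b c x => ?_, fun e x => ?_⟩
  · change D.nabla e x v + (W 1 x v (e x) + W (-1) x v (e x)) ∈ _
    have hz : W (-s) x v (e x) = 0 := by
      have h : V.proj (-s) x (e x) = 0 := V.proj_eq_zero (by rw [neg_neg]; exact he x)
      rw [hW, V.pairing_proj_left, h, _root_.map_zero, _root_.map_zero, zero_smul, zero_smul,
        sub_zero, smul_zero]
    have hm : W s x v (e x) ∈ V.sub s x :=
      Submodule.smul_mem _ _ (Submodule.sub_mem _ (Submodule.smul_mem _ _ (V.proj_mem s x _))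
        (Submodule.smul_mem _ _ (V.proj_mem s x _)))
    refine Submodule.add_mem _ (hD s e he x v) ?_
    rcases Int.units_eq_one_or s with rfl | rfl
    · rwa [hz, add_zero]
    · rw [neg_neg] at hz
      rwa [hz, zero_add]
  -- The six products in the torsion of W cancel in pairs by symmetry of the pairing on V_s.
  · rw [D.torsion_addTensor, hT, zero_add]
    simp only [LinearMap.add_apply, _root_.map_add, hWp]
    have hs (s) (v w : E x) : C.pairing x (V.proj s x v) w = C.pairing x (V.proj s x w) v := by
      rw [V.pairing_proj_left, C.pairing_symm]
    rw [hs 1 (b x) (a x), hs 1 (c x) (a x), hs 1 (c x) (b x), hs (-1) (b x) (a x),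
      hs (-1) (c x) (a x), hs (-1) (c x) (b x)]
    ring
  · change LinearMap.trace ℝ (E x) (D.nabla e x + (W 1 x + W (-1) x).flip (e x)) = _
    have h : (W 1 x + W (-1) x).flip (e x) = (W 1 x).flip (e x) + (W (-1) x).flip (e x) := rfl
    rw [h, _root_.map_add, _root_.map_add, hWtr, hWtr, ← _root_.map_add, V.proj_add_proj, hL]
    exact add_sub_cancel _ _

end GeneralizedMetric

end LeviCivita

end CourantGeometry

end

theorem proposition5p3 {k₁ k₂ m₁ m₂ n : ℕ}
    {B : Type*} [TopologicalSpace B] [T2Space B] [SigmaCompactSpace B]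
    [ChartedSpace (EuclideanSpace ℝ (Fin n)) B] [IsManifold (𝓡 n) ∞ B]
    {T₁ : Type*} [TopologicalSpace T₁] [T2Space T₁] [CompactSpace T₁] [ConnectedSpace T₁]
    [ChartedSpace (EuclideanSpace ℝ (Fin k₁)) T₁] [CommGroup T₁] [LieGroup (𝓡 k₁) ∞ T₁]
    {M₁ : Type*} [TopologicalSpace M₁] [T2Space M₁] [SigmaCompactSpace M₁]
    [ChartedSpace (EuclideanSpace ℝ (Fin m₁)) M₁] [IsManifold (𝓡 m₁) ∞ M₁]
    [MulAction T₁ M₁] [ContMDiffSMul (𝓡 k₁) (𝓡 m₁) ∞ T₁ M₁]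
    {F₁ : Type*} [NormedAddCommGroup F₁] [NormedSpace ℝ F₁] [FiniteDimensional ℝ F₁]
    {E₁ : M₁ → Type*} [TopologicalSpace (TotalSpace F₁ E₁)] [∀ x, TopologicalSpace (E₁ x)]
    [FiberBundle F₁ E₁] [∀ x, AddCommGroup (E₁ x)] [∀ x, Module ℝ (E₁ x)]
    [VectorBundle ℝ F₁ E₁] [ContMDiffVectorBundle ∞ F₁ E₁ (𝓡 m₁)]
    {T₂ : Type*} [TopologicalSpace T₂] [T2Space T₂] [CompactSpace T₂] [ConnectedSpace T₂]
    [ChartedSpace (EuclideanSpace ℝ (Fin k₂)) T₂] [CommGroup T₂] [LieGroup (𝓡 k₂) ∞ T₂]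
    {M₂ : Type*} [TopologicalSpace M₂] [T2Space M₂] [SigmaCompactSpace M₂]
    [ChartedSpace (EuclideanSpace ℝ (Fin m₂)) M₂] [IsManifold (𝓡 m₂) ∞ M₂]
    [MulAction T₂ M₂] [ContMDiffSMul (𝓡 k₂) (𝓡 m₂) ∞ T₂ M₂]
    {F₂ : Type*} [NormedAddCommGroup F₂] [NormedSpace ℝ F₂] [FiniteDimensional ℝ F₂]
    {E₂ : M₂ → Type*} [TopologicalSpace (TotalSpace F₂ E₂)] [∀ x, TopologicalSpace (E₂ x)]
    [FiberBundle F₂ E₂] [∀ x, AddCommGroup (E₂ x)] [∀ x, Module ℝ (E₂ x)]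
    [VectorBundle ℝ F₂ E₂] [ContMDiffVectorBundle ∞ F₂ E₂ (𝓡 m₂)]
    (𝓔₁ : EquivariantCourantAlgebroid k₁ m₁ n T₁ B F₁ E₁)
    (𝓔₂ : EquivariantCourantAlgebroid k₂ m₂ n T₂ B F₂ E₂)
    (ψ : DualityIso 𝓔₁ 𝓔₂)
    (V₁ : GeneralizedMetric 𝓔₁.courant) (div₁ : DivergenceOperator 𝓔₁.courant)
    (hV₁ : 𝓔₁.InvariantMetric V₁) (hdiv₁ : 𝓔₁.InvariantDivergence div₁)
    (V₂ : GeneralizedMetric 𝓔₂.courant) (div₂ : DivergenceOperator 𝓔₂.courant)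
    (hV₂ : 𝓔₂.InvariantMetric V₂) (hdiv₂ : 𝓔₂.InvariantDivergence div₂)
    (hdual : DualPairs ψ V₁ div₁ V₂ div₂) :
    ((∀ s x, Module.finrank ℝ (V₁.sub s x) ≠ 1) → (V₁.leviCivita div₁).Nonempty) ∧
    ((∀ s x, Module.finrank ℝ (V₂.sub s x) ≠ 1) → (V₂.leviCivita div₂).Nonempty) ∧
    ∀ D₁ ∈ V₁.leviCivita div₁, ∀ D₂ ∈ V₂.leviCivita div₂, ∀ (s : ℤˣ) (e₁ e₂ : 𝓔₁.redSec),
      EqualPushforward 𝓔₁ 𝓔₂ (V₁.ricci s D₁ e₁.1 e₂.1)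
        (V₂.ricci s D₂ (ψ.sec e₁).1 (ψ.sec e₂).1) :=
  ⟨fun h => V₁.leviCivita_nonempty div₁ h, fun h => V₂.leviCivita_nonempty div₂ h,
    fun _ hD₁ _ hD₂ s e₁ e₂ => ψ.equalPushforward_ricci hV₁ hV₂ hdual hD₁ hD₂ s e₁ e₂⟩
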